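/- **Algebra.** An S-algebra is a set $\mathcal E$ with a commutative associative operation $\boxplus$, constants $0,1$ and a unary operation $'$ such that $a\boxplus a'=1$, $a\boxplus 0=a$, $a''=a$, $a\boxplus 1=1$. Put $a\odot b=(a'\boxplus b')'$, $a\sqcap b=(a\boxplus b')\odot b$, $a\sqcup b=(a\odot b')\boxplus b$. It is a QMV algebra if $a\sqcup(b\sqcap a)=a$; $(a\sqcap b)\sqcap c=(a\sqcap b)\sqcap(b\sqcap c)$; $a\boxplus(b\sqcap(a\boxplus c)')=(a\boxplus b)\sqcap(a\boxplus(a\boxplus c)')$; $a\boxplus(a'\sqcap b)=a\boxplus b$; and $(a'\boxplus b)\sqcup(b'\boxplus a)=1$. It is lattice-ordered if the relation $a\le b\iff a=a\sqcap b$ is a lattice order; it is locally finite if for every $a\ne0$ some multiple $a\boxplus\cdots\boxplus a$ equals $1$. **Machines.** Let $\Sigma$ be a finite alphabet. An $\mathcal E$NTM $M=(Q,\Sigma,\Gamma,\delta,B,I,T)$ has a finite nonempty state set $Q$, a finite tape alphabet $\Gamma\supseteq\Sigma\cup\{B\}$ with blank $B\notin\Sigma$, and functions $\delta:Q\times\Gamma\times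 Q\times\Gamma\times\{L,S,R\}\to\mathcal E$ and $I,T:Q\to\mathcal E$. An instantaneous description (ID) $C$ consists of a state $St(C)$, a two-way infinite tape with finitely many non-blank cells, and a head position; a transition $(p,a,q,b,D)$ applies to an ID with state $p$ and scanned symbol $a$, writes $b$, moves the head by $D$ and passes to state $q$. $M$ halts at $C$ if $T(St(C))<1$, or if $T(St(C))=1$ and all transitions applicable to $C$ have value $1$. A halting path on $s\in\Sigma^+$ is a sequence of $n\ge1$ successive transitions from the ID $q_0s$ (state $q_0$, tape content $s$, head on the first symbol of $s$) to an ID $C_n$, such that $I(q_0)\neq1$, all transition values $v_1,\dots,v_n$ are $\ne1$, $M$ halts at $C_n$ and $M$ does not halt at any earlier ID of the path. Its value is $I(q_0)\boxplus v_1\boxplus\cdots\boxplus v_n\boxplus T(St(C_n))$. The $\mathcal E$-valued language $|M|_d$ is the partial function $\Sigma^+\rightharpoonup\mathcal E$ sending $s$ to the infimum of the values of all halting paths on $s$; it is undefined if there is no halting path. $M$ is an $\mathcal E$DTM if for all $p,a$ there is at most one $(q,b,D)$ with $\delta(p,a,q,b,D)\neq1$, and there is at most one initial state, i.e. at most one $q$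 with $I(q)\ne1$. **Universal language.** Code rules (state $i$, read $j$; next state $k$, write $l$, move $m$) of classical deterministic single-tape Turing machines with input alphabet $\{0,1\}$, whose states, tape symbols and moves are numbered by positive integers, as $0^i10^j10^k10^l10^m$, and code a machine, given by a finite list of rules of which the first applicable one is used, as the list of the codes of its rules separated by $11$. $L_u\subseteq\{0,1\}^*$ is the set of all words $\langle N\rangle\,111\,w$ such that $w\in\{0,1\}^*$ and the machine $N$ accepts $w$ (i.e. reaches its accepting state). **Theorem.** Let $\mathcal E$ be a lattice-ordered QMV algebra with $0\neq1$. 1. $\mathcal E$NTMs are not equivalent to, and strictly more powerful than, $\mathcal E$DTMs: for every finite nonempty alphabet $\Sigma$, $$\{|M|_d : M\text{ an }\mathcal E\text{DTM over }\Sigma\}\subsetneq\{|M|_d : M\text{ an }\mathcal E\text{NTM over }\Sigma\}.$$ 2. If $\mathcal E$ is locally finite, then every $\mathcal E$DTM $M$ over a finite alphabet $\Sigma$ can be simulated by a classical deterministic two-tape Turing machine $N$: there is a map $\mathrm{val}$ from the second-tape alphabet of $N$ to $\mathcal E$ such that for every $s\in\Sigma^+$, $N$, started with $s$ on the first tape and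 a blank second tape, halts iff $|M|_d(s)$ is defined, and then $|M|_d(s)=\mathrm{val}(c)$ for the symbol $c$ finally scanned on the second tape. 3. For every $x\in\mathcal E$ with $0<x<1$ there is an $\mathcal E$NTM $M$ over $\{0,1\}$ with $|M|_d(s)=0$ for all $s\in L_u$ and $|M|_d(s)=x$ for all $s\in\{0,1\}^+\setminus L_u$. Its level set $\{s:|M|_d(s)=x\}=\{0,1\}^+\setminus L_u$ is not recursively enumerable. -/

import Mathlib

/-- A supplement algebra (S-algebra). The operation `⊞` is written `+`, the supplement `a'` is
written `aᶜ`. Commutativity, associativity and `a ⊞ 0 = a` come from `AddCommMonoid`. -/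
class SAlgebra (E : Type*) extends AddCommMonoid E, One E, Compl E where
  add_supp : ∀ a : E, a + aᶜ = 1
  supp_supp : ∀ a : E, aᶜᶜ = a
  add_one_eq : ∀ a : E, a + 1 = 1

namespace SAlgebra

variable {E : Type*} [SAlgebra E]

/-- `a ⊙ b = (a' ⊞ b')'`. -/
def odot (a b : E) : E := (aᶜ + bᶜ)ᶜ

/-- The operation `a ⊓ b = (a ⊞ b') ⊙ b` (in general not a lattice operation). -/
def qinf (a b : E) : E := odot (a + bᶜ) b

/-- The operation `a ⊔ b = (a ⊙ b') ⊞ b` (in general not a lattice operation). -/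
def qsup (a b : E) : E := odot a bᶜ + b

end SAlgebra

open SAlgebra in
/-- A quantum MV algebra. -/
class QMVAlgebra (E : Type*) extends SAlgebra E where
  qmv1 : ∀ a b : E, qsup a (qinf b a) = a
  qmv2 : ∀ a b c : E, qinf (qinf a b) c = qinf (qinf a b) (qinf b c)
  qmv3 : ∀ a b c : E, a + qinf b (a + c)ᶜ = qinf (a + b) (a + (a + c)ᶜ)
  qmv4 : ∀ a b : E, a + qinf aᶜ b = a + b
  qmv5 : ∀ a b : E, qsup (aᶜ + b) (bᶜ + a) = 1

/-- A lattice-ordered QMV algebra: the relation `a ≤ b ↔ a = a ⊓ b` is a lattice order. -/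
class LatticeQMVAlgebra (E : Type*) extends QMVAlgebra E, Lattice E where
  le_iff_eq_qinf : ∀ a b : E, a ≤ b ↔ a = SAlgebra.qinf a b

/-- Local finiteness: every nonzero element has a finite multiple equal to `1`. -/
def IsLocallyFinite (E : Type*) [SAlgebra E] : Prop :=
  ∀ a : E, a ≠ 0 → ∃ n : ℕ, n • a = 1

/-- Head movements: left, stationary, right. -/
inductive HeadMove where
  | L
  | S
  | R

/-- Write `b` in the scanned cell of a tape and then move the head. -/
def writeMove {G : Type*} [Inhabited G] (t : Turing.Tape G) (b : G) : HeadMove → Turing.Tape G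
  | HeadMove.L => (t.write b).move Turing.Dir.left
  | HeadMove.S => t.write b
  | HeadMove.R => (t.write b).move Turing.Dir.right

/-- Nonempty words over the alphabet `A`. -/
abbrev NeWord (A : Type*) := {s : List A // s ≠ []}

/-- An `E`-valued non-deterministic Turing machine with input alphabet `A`. -/
structure ENTM (E : Type*) (A : Type) where
  /-- states -/
  Q : Type
  finQ : Finite Q
  nonemptyQ : Nonempty Q
  /-- tape symbols -/
  Γ : Type
  finΓ : Finite Γ
  /-- the blank symbol -/
  B : Γ
  /-- the input symbols are non-blank tape symbols -/
  inp : A ↪ Γ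
  inp_ne_blank : ∀ a, inp a ≠ B
  /-- the transition function: `δ p a q b D` -/
  δ : Q → Γ → Q → Γ → HeadMove → E
  /-- the initial-state function -/
  I : Q → E
  /-- the final-state function -/
  T : Q → E

namespace ENTM

variable {E : Type*} [LatticeQMVAlgebra E] {A : Type}

/-- Unwritten cells of the tape hold the blank symbol. -/
instance (M : ENTM E A) : Inhabited M.Γ := ⟨M.B⟩

/-- Instantaneous descriptions: a state and a tape (a two-way infinite tape that is blank
outside a finite part, together with the head position). -/
structure ID (M : ENTM E A) where
  st : M.Q
  tape : Turing.Tape M.Γ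

/-- The instantaneous description `q s`: state `q`, head on the first symbol of `s`. -/
def initID (M : ENTM E A) (q : M.Q) (s : List A) : M.ID :=
  ⟨q, Turing.Tape.mk₁ (s.map M.inp)⟩

/-- `M` halts at `C` if `T (St C) < 1`, or if `T (St C) = 1` and every transition from `C` has
value `1`. -/
def Halted (M : ENTM E A) (C : M.ID) : Prop :=
  M.T C.st < 1 ∨ (M.T C.st = 1 ∧ ∀ q b D, M.δ C.st C.tape.head q b D = 1)

/-- `M.Path s n C v`: there is an effective path `q₀ s = C₀, C₁, …, C_n = C` (all its transitions
and `I q₀` have values different from `1`), on which `M` has not halted before `C_n`, with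
`v = I q₀ ⊞ δ⋆(C₀, C₁) ⊞ ⋯ ⊞ δ⋆(C_{n-1}, C_n)`. -/
inductive Path (M : ENTM E A) (s : List A) : ℕ → M.ID → E → Prop
  | init (q₀ : M.Q) (h : M.I q₀ ≠ 1) : Path M s 0 (M.initID q₀ s) (M.I q₀)
  | step {n : ℕ} {C : M.ID} {v : E} (hC : Path M s n C v) (hn : ¬ M.Halted C)
      (q : M.Q) (b : M.Γ) (D : HeadMove) (h : M.δ C.st C.tape.head q b D ≠ 1) :
      Path M s (n + 1) ⟨q, writeMove C.tape b D⟩ (v + M.δ C.st C.tape.head q b D)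

/-- The values `I q₀ ⊞ δ⋆(C₀, C₁) ⊞ ⋯ ⊞ δ⋆(C_{n-1}, C_n) ⊞ T (St C_n)`, `n ≥ 1`, of the halting
paths of `M` on the input `s`. -/
def pathValues (M : ENTM E A) (s : List A) : Set E :=
  {v | ∃ n C u, 1 ≤ n ∧ M.Path s n C u ∧ M.Halted C ∧ v = u + M.T C.st}

/-- The `E`-valued language (a partial function) accepted by `M` in the depth-first manner: the
infimum of the values of all halting paths, undefined if there is no halting path. -/
noncomputable def lang (M : ENTM E A) (s : NeWord A) : Part E :=
  ⟨(M.pathValues s.1).Nonempty ∧ ∃ v, IsGLB (M.pathValues s.1) v, fun h => h.2.choose⟩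

theorem mem_lang_iff (M : ENTM E A) (s : NeWord A) (v : E) :
    v ∈ M.lang s ↔ (M.pathValues s.1).Nonempty ∧ IsGLB (M.pathValues s.1) v := by
  constructor
  · rintro ⟨h, rfl⟩
    exact ⟨h.1, h.2.choose_spec⟩
  · rintro ⟨h, hv⟩
    exact ⟨⟨h, v, hv⟩, IsGLB.unique (Exists.choose_spec (⟨v, hv⟩ : ∃ v, _)) hv⟩

/-- `M` is an `E`-valued deterministic Turing machine: for any `p` and `a` at most one triple
`(q, b, D)` has `δ p a q b D ≠ 1`, and there is at most one initial state (a state with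
`I q ≠ 1`). -/
def IsDeterministic (M : ENTM E A) : Prop :=
  (∀ p a q b D q' b' D', M.δ p a q b D ≠ 1 → M.δ p a q' b' D' ≠ 1 →
    q = q' ∧ b = b' ∧ D = D') ∧
  (∀ q q', M.I q ≠ 1 → M.I q' ≠ 1 → q = q')

end ENTM

/-- The `E`-valued languages over `A` accepted by `E`-valued non-deterministic machines. -/
def ntmLanguages (E : Type*) [LatticeQMVAlgebra E] (A : Type) : Set (NeWord A → Part E) :=
  {L | ∃ M : ENTM E A, L = M.lang}

/-- The `E`-valued languages over `A` accepted by `E`-valued deterministic machines. -/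
def dtmLanguages (E : Type*) [LatticeQMVAlgebra E] (A : Type) : Set (NeWord A → Part E) :=
  {L | ∃ M : ENTM E A, M.IsDeterministic ∧ L = M.lang}

/-- The set of words on which an `E`-valued language takes the value `x`. -/
def levelSet {E : Type*} {A : Type} (L : NeWord A → Part E) (x : E) : Set (List A) :=
  {w | ∃ h : w ≠ [], x ∈ L ⟨w, h⟩}

/-- A classical (deterministic) Turing machine with two tapes and input alphabet `A`. -/
structure TwoTapeTM (A : Type) where
  K : Type
  finK : Finite K
  Γ₁ : Type
  finΓ₁ : Finite Γ₁
  B₁ : Γ₁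
  Γ₂ : Type
  finΓ₂ : Finite Γ₂
  B₂ : Γ₂
  inp : A ↪ Γ₁
  inp_ne_blank : ∀ a, inp a ≠ B₁
  start : K
  /-- the machine halts when the transition function returns `none` -/
  δ : K → Γ₁ → Γ₂ → Option (K × (Γ₁ × HeadMove) × (Γ₂ × HeadMove))

namespace TwoTapeTM

variable {A : Type}

instance (N : TwoTapeTM A) : Inhabited N.Γ₁ := ⟨N.B₁⟩

instance (N : TwoTapeTM A) : Inhabited N.Γ₂ := ⟨N.B₂⟩

/-- Configurations: a state and two tapes. -/
structure Cfg (N : TwoTapeTM A) where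
  st : N.K
  tape₁ : Turing.Tape N.Γ₁
  tape₂ : Turing.Tape N.Γ₂

/-- One step of the machine. -/
def step (N : TwoTapeTM A) (c : N.Cfg) : Option N.Cfg :=
  (N.δ c.st c.tape₁.head c.tape₂.head).map fun r =>
    ⟨r.1, writeMove c.tape₁ r.2.1.1 r.2.1.2, writeMove c.tape₂ r.2.2.1 r.2.2.2⟩

/-- Initially the input is on the first tape and the second tape is blank. -/
def init (N : TwoTapeTM A) (s : List A) : N.Cfg :=
  ⟨N.start, Turing.Tape.mk₁ (s.map N.inp), Turing.Tape.mk₁ []⟩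

/-- The result: the symbol scanned on the second tape when the machine halts, undefined if it does
not halt. -/
def output (N : TwoTapeTM A) (s : List A) : Part N.Γ₂ :=
  (StateTransition.eval N.step (N.init s)).map fun c => c.tape₂.head

end TwoTapeTM

/-- A transition rule `(state, read) ↦ (next, write, dir)` of a classical single-tape machine whose
states and tape symbols are numbered by natural numbers. -/
structure TMRule where
  state : ℕ
  read : ℕ
  next : ℕ
  write : ℕ
  dir : HeadMove

/-- A classical deterministic single-tape Turing machine with input alphabet `{0, 1}`, given by a
finite table of rules, of which the first applicable one is used. State `0` is the start state and
state `1` the accepting state; tape symbol `0` is the blank, `1` and `2` stand for the input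
symbols `0` and `1`, and all other numbers are further tape symbols. -/
abbrev TMTable := List TMRule

namespace TMTable

/-- One step of the machine. -/
def step (P : TMTable) (c : ℕ × Turing.Tape ℕ) : Option (ℕ × Turing.Tape ℕ) :=
  (P.find? fun r => r.state == c.1 && r.read == c.2.head).map fun r =>
    (r.next, writeMove c.2 r.write r.dir)

/-- The initial configuration on the binary word `w`. -/
def init (w : List Bool) : ℕ × Turing.Tape ℕ :=
  (0, Turing.Tape.mk₁ (w.map fun b => cond b 2 1))

/-- The machine accepts `w` if it reaches the accepting state. -/
def Accepts (P : TMTable) (w : List Bool) : Prop :=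
  ∃ t, StateTransition.Reaches (step P) (init w) (1, t)

/-- The number `i` in unary, as a block of zeros of length `i + 1`. -/
def unary (i : ℕ) : List Bool := List.replicate (i + 1) false

/-- Numbers of the head movements. -/
def moveNum : HeadMove → ℕ
  | HeadMove.L => 0
  | HeadMove.R => 1
  | HeadMove.S => 2

/-- The binary code `0^i 1 0^j 1 0^k 1 0^l 1 0^m` of a rule. -/
def encodeRule (r : TMRule) : List Bool :=
  unary r.state ++ [true] ++ unary r.read ++ [true] ++ unary r.next ++ [true] ++
    unary r.write ++ [true] ++ unary (moveNum r.dir)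

/-- The binary code of a machine: the codes of its rules, separated by `11`. -/
def encode (P : TMTable) : List Bool :=
  [true, true].intercalate (P.map encodeRule)

end TMTable

/-- The universal language `L_u`: all binary words `⟨M⟩ 111 w` such that the Turing machine `M`
accepts `w`. -/
def universalLanguage : Set (List Bool) :=
  {z | ∃ (P : TMTable) (w : List Bool),
    z = TMTable.encode P ++ [true, true, true] ++ w ∧ P.Accepts w}

open Turing StateTransition

/-! ### Deterministic single-tape machines -/

/-! Nondeterminism lets a machine take an infimum over a semi-decidable event. For an r.e. language
`L`, let a machine either stop after one step with value `x`, or simulate an acceptor of `L` and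
finish with value `0` on acceptance; its other halting paths have value `1`. The infimum is
attained: it is `0` on `L` and `x` elsewhere (`ENTM.exists_lang_eq`). With `L = L_u`, which is r.e.
(`re_universalLanguage`) and whose complement is not (`not_re_compl_universalLanguage`), this is
claim 3.

For claim 1, take `x = 1` and let `L` be a unary copy of an r.e. set `K` whose complement is not
r.e. The resulting language is total. A deterministic machine has at most one halting path value per
input (`ENTM.pathValues_subsingleton`), and a sum vanishes only if all its summands do
(`SAlgebra.add_eq_zero_iff`). One bit therefore tells whether the final value is nonzero, and a
classical machine semi-decides this (`ENTM.re_lang_ne_zero`). Then the complement of `K` would be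
r.e.

For claim 2, local finiteness makes the additive submonoid generated by the finitely many values of
the machine finite (`IsLocallyFinite.finite_closure`), so the running value fits into one cell of
the second tape (`ENTM.exists_twoTapeTM`).

Two translations link machines to computability: r.e. sets are accepted by finite tape machines
(`REPred.exists_machine`), and reaching a state is r.e. uniformly in the table
(`TMTable.re_reachesState`). -/

/-- One step of the deterministic single-tape machine with transition function `δ`. -/
def detStep {Q Γ : Type*} [Inhabited Γ] (δ : Q → Γ → Option (Q × Γ × HeadMove))
    (c : Q × Tape Γ) : Option (Q × Tape Γ) :=
  (δ c.1 c.2.head).map fun r => (r.1, writeMove c.2 r.2.1 r.2.2)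

/-- The machine with transition function `δ` reaches the state `q₁` from the configuration `c`. -/
def ReachesState {Q Γ : Type*} [Inhabited Γ] (δ : Q → Γ → Option (Q × Γ × HeadMove)) (q₁ : Q)
    (c : Q × Tape Γ) : Prop :=
  ∃ t, Reaches (detStep δ) c (q₁, t)

theorem map_writeMove {Γ Γ' : Type*} [Inhabited Γ] [Inhabited Γ'] (g : PointedMap Γ Γ')
    (t : Tape Γ) (b : Γ) (D : HeadMove) :
    (writeMove t b D).map g = writeMove (t.map g) (g b) D := by
  cases D <;> simp [writeMove, Tape.map_move, Tape.map_write]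

theorem writeMove_head {Γ : Type*} [Inhabited Γ] (t : Tape Γ) :
    writeMove t t.head HeadMove.S = t := Tape.write_self t

theorem detStep_map {Q Γ Q' Γ' : Type*} [Inhabited Γ] [Inhabited Γ']
    {δ : Q → Γ → Option (Q × Γ × HeadMove)} {δ' : Q' → Γ' → Option (Q' × Γ' × HeadMove)}
    (f : Q → Q') (g : PointedMap Γ Γ')
    (h : ∀ q a, δ' (f q) (g a) = (δ q a).map fun r => (f r.1, g r.2.1, r.2.2)) (c : Q × Tape Γ) :
    detStep δ' (f c.1, c.2.map g) = (detStep δ c).map fun c => (f c.1, c.2.map g) := by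
  simp [detStep, h, Tape.map_fst, Function.comp_def, map_writeMove]

/-- State reachability is preserved and reflected by maps commuting with the transitions. -/
theorem reachesState_map {Q Γ Q' Γ' : Type*} [Inhabited Γ] [Inhabited Γ']
    {δ : Q → Γ → Option (Q × Γ × HeadMove)} {δ' : Q' → Γ' → Option (Q' × Γ' × HeadMove)}
    (f : Q → Q') (g : PointedMap Γ Γ')
    (h : ∀ q a, δ' (f q) (g a) = (δ q a).map fun r => (f r.1, g r.2.1, r.2.2))
    {q₁ : Q} (hq₁ : ∀ q, f q = f q₁ → q = q₁) (c : Q × Tape Γ) :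
    ReachesState δ' (f q₁) (f c.1, c.2.map g) ↔ ReachesState δ q₁ c := by
  have key := detStep_map f g h
  constructor
  · rintro ⟨t, ht⟩
    have : ∀ d', Reaches (detStep δ') (f c.1, c.2.map g) d' →
        ∃ d, d' = (f d.1, d.2.map g) ∧ Reaches (detStep δ) c d := by
      intro d' hd
      induction hd with
      | refl => exact ⟨c, rfl, Relation.ReflTransGen.refl⟩
      | tail _ hs ih =>
        obtain ⟨d, rfl, hd⟩ := ih
        rw [Option.mem_def, key, Option.map_eq_some_iff] at hs
        obtain ⟨e, he, rfl⟩ := hs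
        exact ⟨e, rfl, hd.tail he⟩
    obtain ⟨⟨q, s⟩, he, hd⟩ := this _ ht
    cases hq₁ q (Prod.ext_iff.1 he).1.symm
    exact ⟨s, hd⟩
  · rintro ⟨t, ht⟩
    refine ⟨t.map g, Relation.ReflTransGen.lift (fun d : Q × Tape Γ => (f d.1, d.2.map g))
      (fun a b hab => ?_) _ _ ht⟩
    rw [Option.mem_def] at hab
    change detStep δ' (f a.1, a.2.map g) = _
    rw [key, hab]; rfl

/-! ### Numbering states and symbols; tables for finite machines -/

/-- A countable type can be numbered so that given elements get the first numbers. -/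
theorem exists_numbering {X : Type*} [Countable X] (l : List X) :
    ∃ f : X → ℕ, Function.Injective f ∧ ∀ x ∈ l, ∀ [BEq X] [LawfulBEq X], f x = l.idxOf x := by
  classical
  obtain ⟨e, he⟩ := exists_injective_nat X
  -- The numbers below `l.length` are reserved for members of `l`; all other elements are shifted
  -- past them.
  refine ⟨fun x => if x ∈ l then l.idxOf x else e x + l.length, ?_, ?_⟩
  · intro x y hxy
    dsimp only at hxy
    by_cases hx : x ∈ l <;> by_cases hy : y ∈ l <;> simp only [hx, hy, if_true, if_false] at hxy
    · exact (List.idxOf_inj hx).1 hxy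
    · have := List.idxOf_lt_length_of_mem hx; omega
    · have := List.idxOf_lt_length_of_mem hy; omega
    · exact he (by omega)
  · intro x hx _ _
    simp only [hx, if_true]
    congr!

namespace TMTable

/-- The transition function of a table. -/
def trans (P : TMTable) (q a : ℕ) : Option (ℕ × ℕ × HeadMove) :=
  (P.find? fun r => r.state == q && r.read == a).map fun r => (r.next, r.write, r.dir)

theorem step_eq_detStep (P : TMTable) : P.step = detStep P.trans := by
  funext c
  simp [step, detStep, trans, Function.comp_def]

theorem accepts_iff (P : TMTable) (w : List Bool) :
    P.Accepts w ↔ ReachesState P.trans 1 (init w) := by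
  rw [Accepts, step_eq_detStep, ReachesState]

/-- The table of a finite machine, relative to numberings of its states and symbols. -/
theorem exists_trans_eq {Q Γ : Type*} [Finite Q] [Finite Γ]
    (δ : Q → Γ → Option (Q × Γ × HeadMove)) {f : Q → ℕ} {g : Γ → ℕ} (hf : Function.Injective f)
    (hg : Function.Injective g) :
    ∃ P : TMTable, ∀ q a,
      P.trans (f q) (g a) = (δ q a).map fun r => (f r.1, g r.2.1, r.2.2) := by
  classical
  have := Fintype.ofFinite Q
  have := Fintype.ofFinite Γ
  let rule (x : Q × Γ) (r : Q × Γ × HeadMove) : TMRule := ⟨f x.1, g x.2, f r.1, g r.2.1, r.2.2⟩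
  -- The order of the rules is immaterial: by injectivity of `f` and `g`, at most one rule matches a
  -- given state and symbol.
  let P : TMTable := (Finset.univ : Finset (Q × Γ)).toList.filterMap fun x =>
    (δ x.1 x.2).map (rule x)
  have hP : ∀ r, r ∈ P ↔ ∃ q a s, δ q a = some s ∧ rule (q, a) s = r := by
    intro r
    simp [P, List.mem_filterMap]
  refine ⟨P, fun q a => ?_⟩
  rw [trans]
  rcases hfind : P.find? (fun r => r.state == f q && r.read == g a) with _ | r
  · rcases hδ : δ q a with _ | s
    · rw [hfind]; rfl
    · have := List.find?_eq_none.1 hfind _ ((hP _).2 ⟨q, a, s, hδ, rfl⟩)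
      simp [rule] at this
  · obtain ⟨q', a', s, hs, rfl⟩ := (hP r).1 (List.mem_of_find?_eq_some hfind)
    have := List.find?_some hfind
    simp only [rule, Bool.and_eq_true, beq_iff_eq] at this
    cases hf this.1
    cases hg this.2
    rw [hfind, hs]; rfl

/-- Every finite machine is simulated by a table. -/
theorem exists_reachesState_iff {Q Γ : Type*} [Finite Q] [Finite Γ] [Inhabited Γ]
    (δ : Q → Γ → Option (Q × Γ × HeadMove)) {q₀ q₁ : Q} (hq : q₀ ≠ q₁) {g : Γ → ℕ}
    (hg : Function.Injective g) (hg₀ : g default = 0) :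
    ∃ P : TMTable, ∀ w : List Γ, ReachesState P.trans 1 (0, Tape.mk₁ (w.map g)) ↔
      ReachesState δ q₁ (q₀, Tape.mk₁ w) := by
  classical
  obtain ⟨f, hf, hl⟩ := exists_numbering [q₀, q₁]
  have h₀ : f q₀ = 0 := by simpa using hl q₀ (by simp)
  have h₁ : f q₁ = 1 := by simpa [List.idxOf_cons, hq] using hl q₁ (by simp)
  obtain ⟨P, hP⟩ := exists_trans_eq δ hf hg
  refine ⟨P, fun w => ?_⟩
  have := reachesState_map f (PointedMap.mk g hg₀) hP (q₁ := q₁) (fun q h => hf h) (q₀, Tape.mk₁ w)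
  rwa [h₀, h₁, Tape.map_mk₁] at this

end TMTable

/-! ### Machines for recursively enumerable sets -/

namespace Turing.TM0

variable {Γ Λ : Type*} [Inhabited Λ] [Inhabited Γ]

open scoped Classical in
/-- The restriction of a Post machine to a supporting set of states, with an additional accepting
state `none` that is entered when the machine halts. -/
noncomputable def toTrans (M : Machine Γ Λ) (S : Set Λ) :
    Option S → Γ → Option (Option S × Γ × HeadMove)
  | none, _ => none
  | some q, a => match M q a with
    | none => some (none, a, HeadMove.S)
    | some (q', s) => if h : q' ∈ S then
        some (some ⟨q', h⟩, match s with
          | Stmt.move Dir.left => (a, HeadMove.L)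
          | Stmt.move Dir.right => (a, HeadMove.R)
          | Stmt.write b => (b, HeadMove.S))
      else none

/-- A supporting set is closed under transitions, so the branch of `toTrans` for successors outside
`S` is never taken. -/
theorem detStep_toTrans_of_some {M : Machine Γ Λ} {S : Set Λ} (hS : Supports M S) {q q' : Λ}
    {T T' : Tape Γ} (hq : q ∈ S) (h : step M ⟨q, T⟩ = some ⟨q', T'⟩) :
    ∃ hq' : q' ∈ S, detStep (toTrans M S) (some ⟨q, hq⟩, T) = some (some ⟨q', hq'⟩, T') := by
  obtain ⟨⟨p, s⟩, hps, he⟩ := Option.map_eq_some_iff.1 h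
  cases he
  have hq' : q' ∈ S := hS.2 hps hq
  refine ⟨hq', ?_⟩
  rcases s with (_ | _) | b <;>
    simp [detStep, toTrans, hps, hq', writeMove, Tape.write_self]

theorem detStep_toTrans_of_none {M : Machine Γ Λ} {S : Set Λ} {q : Λ} {T : Tape Γ} (hq : q ∈ S)
    (h : step M ⟨q, T⟩ = none) :
    detStep (toTrans M S) (some ⟨q, hq⟩, T) = some (none, T) := by
  have h : M q T.head = none := Option.map_eq_none_iff.1 h
  simp [detStep, toTrans, h, writeMove, Tape.write_self]

/-- Halting becomes reachability of a state, because the halted machine makes one extra step into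
`none` and nothing else leads there. -/
theorem reachesState_toTrans_iff {M : Machine Γ Λ} {S : Set Λ} (hS : Supports M S) (l : List Γ) :
    ReachesState (toTrans M S) none (some ⟨default, hS.1⟩, Tape.mk₁ l) ↔ (eval M l).Dom := by
  change _ ↔ (StateTransition.eval (step M) (init l)).Dom
  constructor
  · rintro ⟨t, ht⟩
    have key : ∀ d, Relation.ReflTransGen (fun a b => b ∈ detStep (toTrans M S) a)
          (some ⟨default, hS.1⟩, Tape.mk₁ l) d →
        (∃ q, d.1 = some q ∧ StateTransition.Reaches (step M) (init l) ⟨q, d.2⟩) ∨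
          (d.1 = none ∧ (StateTransition.eval (step M) (init l)).Dom) := by
      intro d hd
      induction hd with
      | refl => exact Or.inl ⟨_, rfl, Relation.ReflTransGen.refl⟩
      | @tail d e _ hs ih =>
        obtain ⟨d₁, T⟩ := d
        rcases ih with ⟨q, hq, hr⟩ | ⟨hq, hr⟩
        · cases hq
          rcases hstep : step M ⟨q.1, T⟩ with _ | ⟨q', T'⟩
          · have := detStep_toTrans_of_none q.2 hstep
            rw [Option.mem_def, this, Option.some_inj] at hs
            subst hs
            exact Or.inr ⟨rfl, Part.dom_iff_mem.2 ⟨_, mem_eval.2 ⟨hr, hstep⟩⟩⟩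
          · obtain ⟨hq', he⟩ := detStep_toTrans_of_some hS q.2 hstep
            rw [Option.mem_def, he, Option.some_inj] at hs
            subst hs
            exact Or.inl ⟨_, rfl, hr.tail hstep⟩
        · cases hq
          simp [detStep, toTrans] at hs
    rcases key _ ht with ⟨q, hq, _⟩ | ⟨_, h⟩
    · cases hq
    · exact h
  · intro h
    obtain ⟨⟨q, T⟩, hc⟩ := Part.dom_iff_mem.1 h
    obtain ⟨hr, hn⟩ := mem_eval.1 hc
    have key : ∀ c : Cfg Γ Λ, StateTransition.Reaches (step M) (init l) c → ∃ hq : c.q ∈ S,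
        StateTransition.Reaches (detStep (toTrans M S)) (some ⟨default, hS.1⟩, Tape.mk₁ l)
          (some ⟨c.q, hq⟩, c.Tape) := by
      intro c hc
      induction hc with
      | refl => exact ⟨hS.1, Relation.ReflTransGen.refl⟩
      | tail _ hs ih =>
        obtain ⟨hq, ih⟩ := ih
        obtain ⟨hq', he⟩ := detStep_toTrans_of_some hS hq hs
        exact ⟨hq', ih.tail he⟩
    obtain ⟨hq, hr'⟩ := key _ hr
    exact ⟨T, hr'.tail (detStep_toTrans_of_none hq hn)⟩

end Turing.TM0

/-- Replacing the output of a semi-decision procedure by the constant `0` gives a partial recursive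
function with domain `p`. -/
theorem REPred.exists_toPartrec_code {p : ℕ → Prop} (hp : REPred p) :
    ∃ c : ToPartrec.Code, ∀ n, (c.eval [n]).Dom ↔ p n := by
  have h : Partrec fun n => (Part.assert (p n) fun _ => Part.some ()).map fun _ => 0 :=
    hp.map (Computable.const 0).to₂
  obtain ⟨c, hc⟩ := ToPartrec.Code.exists_code (Nat.Partrec'.part_iff₁.2 h)
  refine ⟨c, fun n => ?_⟩
  have := hc (n ::ᵥ List.Vector.nil)
  change c.eval [n] = _ at this
  rw [this]
  simp [Part.assert]

open PartrecToTM2 in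
/-- A finite machine accepting those numbers, given in the binary encoding, that belong to a given
recursively enumerable set. -/
theorem REPred.exists_machine_trList {p : ℕ → Prop} (hp : REPred p) :
    ∃ (Q Γ : Type) (_ : Finite Q) (_ : Finite Γ) (_ : Inhabited Γ)
      (δ : Q → Γ → Option (Q × Γ × HeadMove)) (q₀ q₁ : Q) (bot : Γ) (enc : PartrecToTM2.Γ' → Γ),
      q₀ ≠ q₁ ∧ (∀ a, δ q₁ a = none) ∧ ∀ n, ReachesState δ q₁
        (q₀, Tape.mk₁ (bot :: (trNat n).reverse.map enc)) ↔ p n := by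
  obtain ⟨c, hc⟩ := hp.exists_toPartrec_code
  -- The default label is the entry point of the program, so it must be the compiled `c`. The set of
  -- labels supporting this program is finite, which gives a finite state set.
  let _ : Inhabited PartrecToTM2.Λ' := ⟨trNormal c Cont'.halt⟩
  have hS := TM1to0.tr_supports _ (TM2to1.tr_supports _ (tr_supports c Cont'.halt))
  refine ⟨_, TM2to1.Γ' PartrecToTM2.K' (fun _ => PartrecToTM2.Γ'), ?_, ?_, inferInstance,
    TM0.toTrans (TM1to0.tr (TM2to1.tr tr)) _, some ⟨default, hS.1⟩, none,
    -- The main stack lies on the tape bottom first: the separator `cons` closing the list `[n]`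
    -- sits in the cell with the bottom mark `true`, and the digits of `n` follow, most significant
    -- first.
    (true, Function.update (fun _ => none) K'.main (some Γ'.cons)),
    fun a => (false, Function.update (fun _ => none) K'.main (some a)), ?_, fun _ => rfl,
    fun n => ?_⟩
  · infer_instance
  · have : Fintype K' := ⟨{K'.main, K'.rev, K'.aux, K'.stack}, fun k => by cases k <;> simp⟩
    exact inferInstanceAs (Finite (Bool × (K' → Option PartrecToTM2.Γ')))
  · simp
  · have h₁ := TM0.reachesState_toTrans_iff hS (TM2to1.trInit K'.main (trList [n]))
    rw [TM1to0.tr_eval] at h₁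
    replace h₁ := h₁.trans (TM2to1.tr_eval_dom _ _ _)
    have h₂ : (trList [n]).reverse = Γ'.cons :: (trNat n).reverse := by simp [trList]
    rw [TM2to1.trInit, h₂] at h₁
    refine h₁.trans ?_
    have h₃ : (TM2.init K'.main (trList [n]) : PartrecToTM2.Cfg') = init c [n] := by
      simp only [TM2.init, init]
      congr 1
      funext k
      cases k <;> rfl
    change (StateTransition.eval (TM2.step tr) _).Dom ↔ _
    rw [h₃, PartrecToTM2.tr_eval, ← hc]
    rfl

/-! ### Binary words as numbers, and preparation of the input -/

/-- The number whose binary expansion is `1w`. -/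
def binNum (w : List Bool) : ℕ := w.foldl (fun n b => Nat.bit b n) 1

theorem binNum_concat (w : List Bool) (b : Bool) : binNum (w ++ [b]) = Nat.bit b (binNum w) := by
  simp [binNum]

theorem binNum_ne_zero (w : List Bool) : binNum w ≠ 0 := by
  induction w using List.reverseRecOn with
  | nil => simp [binNum]
  | append_singleton w b ih => rw [binNum_concat]; simpa [Nat.bit_eq_zero_iff] using fun h => absurd h ih

/-- The last letter is the parity of the number; the leading `1` keeps initial zeros visible, so
that only the empty word has number `1`. -/
theorem binNum_injective : Function.Injective binNum := by
  intro v
  induction v using List.reverseRecOn with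
  | nil =>
    intro w h
    rcases List.eq_nil_or_concat w with rfl | ⟨w, b, rfl⟩
    · rfl
    · have := binNum_ne_zero w
      simp only [List.concat_eq_append, binNum_concat, Nat.bit_val] at h
      change 1 = _ at h
      omega
  | append_singleton v b ih =>
    intro w h
    rcases List.eq_nil_or_concat w with rfl | ⟨w, b', rfl⟩
    · have := binNum_ne_zero v
      simp only [binNum_concat, Nat.bit_val] at h
      change _ = 1 at h
      omega
    · simp only [List.concat_eq_append, binNum_concat] at h ⊢
      have hb : b = b' ∧ binNum v = binNum w := by
        rw [Nat.bit_val, Nat.bit_val] at h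
        cases b <;> cases b' <;> simp at h ⊢ <;> omega
      rw [hb.1, ih hb.2]

/-- The binary digits used by `PartrecToTM2`. -/
def bitSymbol (b : Bool) : PartrecToTM2.Γ' := cond b PartrecToTM2.Γ'.bit1 PartrecToTM2.Γ'.bit0

/-- For `n = 0` this fails when `b` is `false`, since `0` has no digits. -/
theorem trNat_bit (b : Bool) {n : ℕ} (hn : n ≠ 0) :
    PartrecToTM2.trNat (Nat.bit b n) = bitSymbol b :: PartrecToTM2.trNat n := by
  rw [PartrecToTM2.trNat, ← Num.ofNat'_eq, Num.ofNat'_bit, PartrecToTM2.trNat, ← Num.ofNat'_eq]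
  rcases h : Num.ofNat' n with _ | m
  · exfalso
    apply hn
    have := congrArg (fun x : Num => (x : ℕ)) h
    simpa [Num.ofNat'_eq] using this
  · cases b <;> rfl

/-- Read from the most significant digit, the code is a letterwise image of `w` behind a fixed
digit. A machine given `w` itself therefore only has to put two fixed symbols in front of it, as
`withPreamble` does. -/
theorem trNat_binNum (w : List Bool) : (PartrecToTM2.trNat (binNum w)).reverse =
    PartrecToTM2.Γ'.bit1 :: w.map bitSymbol := by
  induction w using List.reverseRecOn with
  | nil => rfl
  | append_singleton w b ih =>
    rw [binNum_concat, trNat_bit b (binNum_ne_zero w), List.reverse_cons, ih]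
    simp

/-- The transition function `δ` preceded by a preamble that writes the symbols `b`, `a` to the left
of the input. -/
def withPreamble {Q Γ : Type*} (δ : Q → Γ → Option (Q × Γ × HeadMove)) (q₀ : Q) (a b : Γ) :
    Q ⊕ Fin 3 → Γ → Option ((Q ⊕ Fin 3) × Γ × HeadMove)
  | Sum.inl q, c => (δ q c).map fun r => (Sum.inl r.1, r.2)
  | Sum.inr 0, c => some (Sum.inr 1, c, HeadMove.L)
  | Sum.inr 1, _ => some (Sum.inr 2, a, HeadMove.L)
  | Sum.inr 2, _ => some (Sum.inl q₀, b, HeadMove.S)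

theorem reachesState_withPreamble {Q Γ : Type*} [Inhabited Γ]
    (δ : Q → Γ → Option (Q × Γ × HeadMove)) (q₀ : Q) {q₁ : Q} (hq₁ : ∀ a, δ q₁ a = none)
    (a b : Γ) (l : List Γ) :
    ReachesState (withPreamble δ q₀ a b) (Sum.inl q₁) (Sum.inr 0, Tape.mk₁ l) ↔
      ReachesState δ q₁ (q₀, Tape.mk₁ (b :: a :: l)) := by
  have h := reachesState_map (δ := δ) (δ' := withPreamble δ q₀ a b) Sum.inl (PointedMap.mk id rfl)
    (fun q c => rfl) (q₁ := q₁) (fun _ => Sum.inl_injective.eq_iff.1) (q₀, Tape.mk₁ (b :: a :: l))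
  rw [← h, Tape.map_mk₁]
  simp only [List.map_id]
  have hr : Reaches (detStep (withPreamble δ q₀ a b)) (Sum.inr 0, Tape.mk₁ l)
      (Sum.inl q₀, Tape.mk₁ (b :: a :: l)) := by
    refine .head (b := (Sum.inr 1, (Tape.mk₁ l).move Dir.left)) ?_
      (.head (b := (Sum.inr 2, (((Tape.mk₁ l).move Dir.left).write a).move Dir.left)) ?_
        (.single ?_))
    · simp [detStep, withPreamble, writeMove, Tape.write_self]
    · simp [detStep, withPreamble, writeMove]
    · simp [detStep, withPreamble, writeMove, Tape.mk₁, Tape.mk₂, Tape.move_left_mk',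
        Tape.write_mk', ← ListBlank.cons_mk]
  constructor
  · rintro ⟨t, ht⟩
    -- If the accepting configuration came no later than the end of the preamble, the two would
    -- coincide, because `q₁` has no transitions.
    rcases reaches_total hr ht with h | h
    · exact ⟨t, h⟩
    · rw [Reaches, Relation.reflTransGen_iff_eq fun c hc => by
        simp [detStep, withPreamble, hq₁] at hc] at h
      exact ⟨t, h ▸ Relation.ReflTransGen.refl⟩
  · rintro ⟨t, ht⟩
    exact ⟨t, hr.trans ht⟩

/-- Every recursively enumerable set is accepted by a finite machine: words over `A` are read as
binary words by means of `c`. -/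
theorem REPred.exists_machine {p : ℕ → Prop} (hp : REPred p) {A : Type} [Finite A] (c : A → Bool) :
    ∃ (Q Γ : Type) (_ : Finite Q) (_ : Finite Γ) (_ : Inhabited Γ)
      (δ : Q → Γ → Option (Q × Γ × HeadMove)) (q₀ q₁ : Q) (inp : A ↪ Γ),
      q₀ ≠ q₁ ∧ (∀ a, δ q₁ a = none) ∧ (∀ a, inp a ≠ default) ∧
      ∀ w : List A, ReachesState δ q₁ (q₀, Tape.mk₁ (w.map inp)) ↔ p (binNum (w.map c)) := by
  obtain ⟨Q, Γ, _, _, _, δ, q₀, q₁, bot, enc, hq, hq₁, h⟩ := hp.exists_machine_trList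
  -- Since `c` need not be injective, the letters of `A` get tape symbols of their own. They are
  -- read through `π` and only symbols of `Γ` are ever written.
  let π : A ⊕ Γ → Γ := Sum.elim (fun a => enc (bitSymbol (c a))) id
  let δ₁ := withPreamble δ q₀ (enc PartrecToTM2.Γ'.bit1) bot
  let δ₂ : Q ⊕ Fin 3 → A ⊕ Γ → Option ((Q ⊕ Fin 3) × (A ⊕ Γ) × HeadMove) := fun q a =>
    (δ₁ q (π a)).map fun r => (r.1, Sum.inr r.2.1, r.2.2)
  let _ : Inhabited (A ⊕ Γ) := ⟨Sum.inr default⟩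
  have hq₁' : ∀ a, δ₁ (Sum.inl q₁) a = none := fun a => by simp [δ₁, withPreamble, hq₁]
  refine ⟨Q ⊕ Fin 3, A ⊕ Γ, inferInstance, inferInstance, inferInstance, δ₂, Sum.inr 0, Sum.inl q₁,
    ⟨Sum.inl, Sum.inl_injective⟩, by simp, fun a => by simp [δ₂, hq₁'], fun a => ?_, fun w => ?_⟩
  · exact Sum.inl_ne_inr
  · rw [← h, trNat_binNum, List.map_cons, ← reachesState_withPreamble δ q₀ hq₁]
    have := reachesState_map (δ := δ₂) (δ' := δ₁) id (PointedMap.mk π rfl)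
      (fun q a => by cases h : δ₁ q (π a) <;> simp [δ₂, h, π]) (q₁ := Sum.inl q₁) (fun _ => id)
      (Sum.inr 0, Tape.mk₁ (w.map Sum.inl))
    rw [Tape.map_mk₁] at this
    simp only [List.map_map, id] at this ⊢
    exact this.symm

/-! ### Recursively enumerable predicates -/

theorem REPred.comp {α β : Type*} [Primcodable α] [Primcodable β] {p : β → Prop} (hp : REPred p)
    {f : α → β} (hf : Computable f) : REPred fun a => p (f a) :=
  Partrec.comp hp hf

theorem REPred.of_exists_nat {α : Type*} [Primcodable α] {R : α → ℕ → Bool}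
    (hR : Computable₂ R) : REPred fun a => ∃ k, R a k = true := by
  have h : Partrec fun a => Nat.rfind fun k => Part.some (R a k) := Partrec.rfind hR.partrec₂
  refine h.dom_re.of_eq fun a => ?_
  refine Nat.rfind_dom'.trans ⟨fun ⟨k, hk, _⟩ => ⟨k, by simpa using hk⟩, fun ⟨k, hk⟩ =>
    ⟨k, by simpa using hk, fun _ => trivial⟩⟩

/-- The witness `k` is the bound in the step-bounded evaluation `evaln`, which is primitive
recursive. -/
theorem REPred.exists_nat {α : Type*} [Primcodable α] {p : α → Prop} (hp : REPred p) :
    ∃ R : α → ℕ → Bool, Computable₂ R ∧ ∀ a, p a ↔ ∃ k, R a k = true := by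
  obtain ⟨c, hc⟩ := Nat.Partrec.Code.exists_code.1 hp
  refine ⟨fun a k => (c.evaln k (Encodable.encode a)).isSome, ?_, fun a => ?_⟩
  · have h := Nat.Partrec.Code.primrec_evaln.comp (Primrec.pair (Primrec.pair
      (Primrec.snd (α := α)) (Primrec.const c)) (Primrec.encode.comp Primrec.fst))
    exact (Primrec.option_isSome.comp h).to_comp
  · have h₁ : p a ↔ (c.eval (Encodable.encode a)).Dom := by
      rw [hc]
      simp [Part.assert, Part.bind]
    rw [h₁, Part.dom_iff_mem]
    simp only [Nat.Partrec.Code.evaln_complete, Option.isSome_iff_exists]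
    exact exists_comm

/-- Recursively enumerable predicates are closed under projection. -/
theorem REPred.exists {α β : Type*} [Primcodable α] [Primcodable β] {p : α × β → Prop}
    (hp : REPred p) : REPred fun a => ∃ b, p (a, b) := by
  obtain ⟨R, hR, h⟩ := hp.exists_nat
  -- The number `n` pairs a code of `b` with a witness for `p (a, b)`, so a single search covers
  -- both.
  have key : Computable₂ fun (a : α) (n : ℕ) =>
      ((Encodable.decode (α := β) n.unpair.1).map fun b => R (a, b) n.unpair.2).getD false := by
    refine Computable.option_getD (Computable.option_map
      (Computable.decode.comp (Computable.fst.comp (Computable.unpair.comp Computable.snd)))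
      (hR.comp₂ ?_ ?_)) (Computable.const _)
    · exact Computable.pair (Computable.fst.comp Computable.fst) Computable.snd
    · exact Computable.snd.comp (Computable.unpair.comp (Computable.snd.comp Computable.fst))
  refine (REPred.of_exists_nat key).of_eq fun a => ?_
  constructor
  · rintro ⟨n, hn⟩
    rcases hd : Encodable.decode (α := β) n.unpair.1 with _ | b
    · simp [hd] at hn
    · exact ⟨b, (h _).2 ⟨n.unpair.2, by simpa [hd] using hn⟩⟩
  · rintro ⟨b, hb⟩
    obtain ⟨k, hk⟩ := (h _).1 hb
    exact ⟨Nat.pair (Encodable.encode b) k, by simpa using hk⟩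

theorem REPred.and {α : Type*} [Primcodable α] {p q : α → Prop} (hp : REPred p) (hq : REPred q) :
    REPred fun a => p a ∧ q a := by
  have hq' : Partrec₂ fun (a : α) (_ : Unit) => Part.assert (q a) fun _ => Part.some () :=
    hq.comp Computable.fst
  refine (Partrec.bind hp hq').dom_re.of_eq fun a => ?_
  simp [Part.assert]

theorem REPred.eq {α β : Type*} [Primcodable α] [Primcodable β] {f g : α → β} (hf : Computable f)
    (hg : Computable g) : REPred fun a => f a = g a := by
  classical
  have h : Computable fun a => decide (f a = g a) :=
    (Primrec.eq (α := β)).decide.to_comp.comp hf hg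
  exact h.computablePred.to_re

/-- The image of a recursively enumerable set under a computable map is recursively enumerable. -/
theorem REPred.image {α β : Type*} [Primcodable α] [Primcodable β] {p : β → Prop} (hp : REPred p)
    {f : β → α} (hf : Computable f) : REPred fun a => ∃ b, f b = a ∧ p b :=
  REPred.exists (p := fun x : α × β => f x.2 = x.1 ∧ p x.2)
    ((REPred.eq (hf.comp Computable.snd) Computable.fst).and (hp.comp Computable.snd))

/-- There is a recursively enumerable set of numbers with a complement that is not recursively
enumerable. -/
theorem exists_re_not_co_re : ∃ K : ℕ → Prop, REPred K ∧ ¬ REPred fun n => ¬ K n := by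
  refine ⟨fun n => ((Denumerable.ofNat Nat.Partrec.Code n).eval 0).Dom,
    (ComputablePred.halting_problem_re 0).comp (Computable.ofNat _), fun h => ?_⟩
  refine ComputablePred.halting_problem_not_re 0 ((h.comp Computable.encode).of_eq fun c => ?_)
  dsimp only
  rw [Denumerable.ofNat_encode]

/-! ### Acceptance by tables is recursively enumerable -/

/-- Letting halted configurations stay put makes the step total without adding reachable
configurations, so reachability is a search over a number of iterations. -/
theorem reaches_iff_exists_iterate {σ : Type*} (f : σ → Option σ) (a b : σ) :
    Reaches f a b ↔ ∃ n, (fun c => (f c).getD c)^[n] a = b := by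
  constructor
  · intro h
    induction h with
    | refl => exact ⟨0, rfl⟩
    | tail _ hs ih =>
      obtain ⟨n, rfl⟩ := ih
      refine ⟨n + 1, ?_⟩
      rw [Option.mem_def] at hs
      simp [Function.iterate_succ_apply', hs]
  · rintro ⟨n, rfl⟩
    induction n with
    | zero => exact Relation.ReflTransGen.refl
    | succ n ih =>
      rw [Function.iterate_succ_apply']
      rcases h : f ((fun c => (f c).getD c)^[n] a) with _ | c
      · simpa [h] using ih
      · simpa [h] using! ih.tail h

/-- Head movements correspond to three numbers. -/
def HeadMove.equivFin : HeadMove ≃ Fin 3 where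
  toFun | .L => 0 | .R => 1 | .S => 2
  invFun | 0 => .L | 1 => .R | 2 => .S
  left_inv D := by cases D <;> rfl
  right_inv i := by fin_cases i <;> rfl

instance : Finite HeadMove := Finite.of_equiv _ HeadMove.equivFin.symm

/-- A rule is a quintuple. -/
def TMRule.equivProd : TMRule ≃ ℕ × ℕ × ℕ × ℕ × HeadMove where
  toFun r := (r.state, r.read, r.next, r.write, r.dir)
  invFun x := ⟨x.1, x.2.1, x.2.2.1, x.2.2.2.1, x.2.2.2.2⟩
  left_inv _ := rfl
  right_inv _ := rfl

instance : Primcodable HeadMove := Primcodable.ofEquiv (Fin 3) HeadMove.equivFin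

instance : Primcodable TMRule :=
  Primcodable.ofEquiv (ℕ × ℕ × ℕ × ℕ × HeadMove) TMRule.equivProd

namespace TMRule

theorem primrec_equivProd : Primrec equivProd := Primrec.of_equiv

theorem primrec_state : Primrec state :=
  (Primrec.fst.comp primrec_equivProd).of_eq fun _ => rfl

theorem primrec_read : Primrec read :=
  (Primrec.fst.comp (Primrec.snd.comp primrec_equivProd)).of_eq fun _ => rfl

theorem primrec_next : Primrec next :=
  (Primrec.fst.comp (Primrec.snd.comp (Primrec.snd.comp primrec_equivProd))).of_eq fun _ => rfl

theorem primrec_write : Primrec write :=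
  (Primrec.fst.comp (Primrec.snd.comp
    (Primrec.snd.comp (Primrec.snd.comp primrec_equivProd)))).of_eq fun _ => rfl

theorem primrec_dir : Primrec dir :=
  (Primrec.snd.comp (Primrec.snd.comp
    (Primrec.snd.comp (Primrec.snd.comp primrec_equivProd)))).of_eq fun _ => rfl

end TMRule

namespace TMTable

/-- The effect of a rule on a configuration given by the state, the tape to the left of the head
(nearest cell first) and the tape from the head on. -/
def applyRule (c : ℕ × List ℕ × List ℕ) (r : TMRule) : ℕ × List ℕ × List ℕ :=
  (r.next, match r.dir with
    | .L => (c.2.1.tail, c.2.1.headI :: r.write :: c.2.2.tail)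
    | .S => (c.2.1, r.write :: c.2.2.tail)
    | .R => (r.write :: c.2.1, c.2.2.tail))

/-- One step of the machine on configurations given by lists; a halted configuration is kept. -/
def listStep (P : TMTable) (c : ℕ × List ℕ × List ℕ) : ℕ × List ℕ × List ℕ :=
  ((P.find? fun r => r.state == c.1 && r.read == c.2.2.headI).map (applyRule c)).getD c

/-- The configuration given by a configuration made of lists. -/
def ofLists (c : ℕ × List ℕ × List ℕ) : ℕ × Tape ℕ :=
  (c.1, Tape.mk' (ListBlank.mk c.2.1) (ListBlank.mk c.2.2))

theorem ofLists_applyRule (c : ℕ × List ℕ × List ℕ) (r : TMRule) :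
    ofLists (applyRule c r) = (r.next, writeMove (ofLists c).2 r.write r.dir) := by
  obtain ⟨q, L, R⟩ := c
  have hw : (Tape.mk' (ListBlank.mk L) (ListBlank.mk R)).write r.write =
      Tape.mk' (ListBlank.mk L) (ListBlank.mk (r.write :: R.tail)) := by
    rw [Tape.write_mk', ListBlank.tail_mk, ListBlank.cons_mk]
  rcases h : r.dir with _ | _ | _ <;>
    simp [applyRule, ofLists, writeMove, h, hw, Tape.move_left_mk', Tape.move_right_mk',
      ListBlank.cons_mk]

/-- Two lists represent a tape up to trailing blanks. The missing cells are read as `0` by `headI`,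
which is the blank, so the list step is exact after passing to tapes. -/
theorem ofLists_listStep (P : TMTable) (c : ℕ × List ℕ × List ℕ) :
    ofLists (listStep P c) = (P.step (ofLists c)).getD (ofLists c) := by
  have h : P.step (ofLists c) =
      ((P.find? fun r => r.state == c.1 && r.read == c.2.2.headI).map (applyRule c)).map
        ofLists := by
    rw [step, Option.map_map]
    congr 1
    · funext r; simp [ofLists_applyRule]
  rw [h, listStep]
  cases (P.find? fun r => r.state == c.1 && r.read == c.2.2.headI).map (applyRule c) <;> rfl

theorem reachesState_iff_exists_iterate (P : TMTable) (q : ℕ) (w : List ℕ) :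
    ReachesState P.trans q (0, Tape.mk₁ w) ↔ ∃ n, ((listStep P)^[n] (0, [], w)).1 = q := by
  have h (n : ℕ) : ofLists ((listStep P)^[n] (0, [], w)) =
      (fun c => (P.step c).getD c)^[n] (0, Tape.mk₁ w) :=
    by
    have hs : Function.Semiconj ofLists (listStep P) fun c => (P.step c).getD c :=
      ofLists_listStep P
    exact (hs.iterate_right n) (0, [], w)
  simp only [ReachesState, ← step_eq_detStep, reaches_iff_exists_iterate, ← h]
  constructor
  · rintro ⟨t, n, hn⟩
    exact ⟨n, congrArg Prod.fst hn⟩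
  · rintro ⟨n, rfl⟩
    exact ⟨_, n, rfl⟩

theorem primrec_applyRule : Primrec₂ applyRule := by
  have hc {α : Type} [Primcodable α] {f : ℕ × List ℕ × List ℕ → α} (hf : Primrec f) :
    Primrec fun x : (ℕ × List ℕ × List ℕ) × TMRule => f x.1 := hf.comp Primrec.fst
  have hr {α : Type} [Primcodable α] {f : TMRule → α} (hf : Primrec f) :
    Primrec fun x : (ℕ × List ℕ × List ℕ) × TMRule => f x.2 := hf.comp Primrec.snd
  have hL := hc (Primrec.fst.comp Primrec.snd)
  have hR := Primrec.list_tail.comp (hc (Primrec.snd.comp Primrec.snd))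
  have hw := hr TMRule.primrec_write
  have hwR := Primrec.list_cons.comp hw hR
  have hd (D : HeadMove) : PrimrecPred fun x : (ℕ × List ℕ × List ℕ) × TMRule => x.2.dir = D :=
    Primrec.eq.comp (hr TMRule.primrec_dir) (Primrec.const D)
  classical
  refine (Primrec.pair (hr TMRule.primrec_next) (Primrec.ite (hd .L)
    (Primrec.pair (Primrec.list_tail.comp hL)
      (Primrec.list_cons.comp (Primrec.list_headI.comp hL) hwR))
    (Primrec.ite (hd .S) (Primrec.pair hL hwR)
      (Primrec.pair (Primrec.list_cons.comp hw hL) hR)))).of_eq fun x => ?_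
  rcases h : x.2.dir with _ | _ | _ <;> simp [applyRule, h]

theorem primrec_listStep : Primrec₂ listStep := by
  have hc : Primrec fun x : TMTable × ℕ × List ℕ × List ℕ => x.2 := Primrec.snd
  have hP : Primrec fun x : TMTable × ℕ × List ℕ × List ℕ => x.1 := Primrec.fst
  have hp : Primrec₂ fun (x : TMTable × ℕ × List ℕ × List ℕ) (r : TMRule) =>
      r.state == x.2.1 && r.read == x.2.2.2.headI :=
    Primrec.and.comp
      (Primrec.beq.comp (TMRule.primrec_state.comp Primrec.snd)
        (Primrec.fst.comp (hc.comp Primrec.fst)))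
      (Primrec.beq.comp (TMRule.primrec_read.comp Primrec.snd)
        (Primrec.list_headI.comp (Primrec.snd.comp (Primrec.snd.comp (hc.comp Primrec.fst)))))
  have hf := Primrec.list_getElem?.comp hP (Primrec.list_findIdx hP hp)
  have hg : Primrec₂ fun (x : TMTable × ℕ × List ℕ × List ℕ) (r : TMRule) => applyRule x.2 r :=
    primrec_applyRule.comp (hc.comp Primrec.fst) Primrec.snd
  refine (Primrec.option_getD.comp (Primrec.option_map hf hg) hc).of_eq fun x => ?_
  simp only [listStep, ← List.find?_eq_getElem?_findIdx]

/-- The state after `n` steps is primitive recursive jointly in the table, the word and `n`. The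
uniformity in the table is what makes the universal language r.e. -/
theorem re_reachesState (q : ℕ) : REPred fun x : TMTable × List ℕ =>
    ReachesState x.1.trans q (0, Tape.mk₁ x.2) := by
  have h : Primrec₂ fun (x : TMTable × List ℕ) (n : ℕ) =>
      ((listStep x.1)^[n] (0, [], x.2)).1 == q := by
    refine Primrec.beq.comp (Primrec.fst.comp (Primrec.nat_iterate Primrec.snd
      (Primrec.pair (Primrec.const 0) (Primrec.pair (Primrec.const [])
        (Primrec.snd.comp Primrec.fst)))
      (primrec_listStep.comp (Primrec.fst.comp (Primrec.fst.comp Primrec.fst)) Primrec.snd)))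
      (Primrec.const q)
  refine (REPred.of_exists_nat h.to_comp).of_eq fun x => ?_
  rw [reachesState_iff_exists_iterate]
  simp

end TMTable

/-! ### The universal language -/

namespace TMTable

theorem unary_append_inj {i j : ℕ} {x y : List Bool}
    (h : unary i ++ true :: x = unary j ++ true :: y) : i = j ∧ x = y := by
  induction i generalizing j with
  | zero =>
    cases j with
    | zero => simpa [unary] using h
    | succ j => simp [unary, List.replicate_succ] at h
  | succ i ih =>
    cases j with
    | zero => simp [unary, List.replicate_succ] at h
    | succ j =>
      have := ih (j := j) (by simpa [unary, List.replicate_succ] using h)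
      exact ⟨by rw [this.1], this.2⟩

theorem moveNum_injective : Function.Injective moveNum := fun a b h => by
  cases a <;> cases b <;> first | rfl | cases h

/-- Each of the five unary blocks is delimited by the next `true`, the last one by the `true` that
begins any separator. -/
theorem encodeRule_append_inj {r r' : TMRule} {x y : List Bool}
    (h : encodeRule r ++ true :: x = encodeRule r' ++ true :: y) : r = r' ∧ x = y := by
  simp only [encodeRule, List.append_assoc, List.singleton_append] at h
  obtain ⟨h₁, h⟩ := unary_append_inj h
  obtain ⟨h₂, h⟩ := unary_append_inj h
  obtain ⟨h₃, h⟩ := unary_append_inj h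
  obtain ⟨h₄, h⟩ := unary_append_inj h
  obtain ⟨h₅, h⟩ := unary_append_inj h
  refine ⟨?_, h⟩
  cases r; cases r'
  simp_all [moveNum_injective.eq_iff]

theorem exists_encodeRule_eq (r : TMRule) : ∃ x, encodeRule r = false :: x :=
  ⟨_, by
    simp only [encodeRule, unary, List.replicate_succ, List.cons_append, List.append_assoc]
    rfl⟩

theorem encode_nil : encode [] = [] := rfl

theorem encode_singleton (r : TMRule) : encode [r] = encodeRule r := by
  simp [encode]

theorem encode_cons_cons (r r' : TMRule) (P : TMTable) :
    encode (r :: r' :: P) = encodeRule r ++ [true, true] ++ encode (r' :: P) := by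
  simp [encode, List.intercalate_cons_cons]

theorem exists_encode_cons_eq (r : TMRule) (P : TMTable) : ∃ x, encode (r :: P) = false :: x := by
  obtain ⟨x, hx⟩ := exists_encodeRule_eq r
  cases P with
  | nil => exact ⟨x, by rw [encode_singleton, hx]⟩
  | cons r' P => exact ⟨_, by rw [encode_cons_cons, hx, List.cons_append, List.cons_append]⟩

/-- The code of a machine can be recovered from a word of the form `⟨P⟩ 111 w`. -/
theorem encode_append_inj {P P' : TMTable} {w w' : List Bool}
    (h : encode P ++ [true, true, true] ++ w = encode P' ++ [true, true, true] ++ w') :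
    P = P' ∧ w = w' := by
  induction P generalizing P' with
  | nil =>
    cases P' with
    | nil => simpa [encode_nil] using h
    | cons r' P' =>
      obtain ⟨x, hx⟩ := exists_encode_cons_eq r' P'
      simp [encode_nil, hx] at h
  | cons r P ih =>
    cases P' with
    | nil =>
      obtain ⟨x, hx⟩ := exists_encode_cons_eq r P
      simp [encode_nil, hx] at h
    | cons r' P' =>
      cases P with
      | nil =>
        cases P' with
        | nil =>
          simp only [encode_singleton, List.append_assoc, List.cons_append, List.nil_append] at h
          obtain ⟨rfl, h⟩ := encodeRule_append_inj h
          simpa using h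
        | cons r₂' P' =>
          -- A rule code starts with `false`, so an inner rule is followed by `110` and the last one
          -- by `111`; the third symbol separates the cases.
          obtain ⟨x, hx⟩ := exists_encode_cons_eq r₂' P'
          simp only [encode_singleton, encode_cons_cons, hx, List.append_assoc, List.cons_append,
            List.nil_append] at h
          simpa using (encodeRule_append_inj h).2
      | cons r₂ P =>
        cases P' with
        | nil =>
          obtain ⟨x, hx⟩ := exists_encode_cons_eq r₂ P
          simp only [encode_singleton, encode_cons_cons, hx, List.append_assoc, List.cons_append,
            List.nil_append] at h
          simpa using (encodeRule_append_inj h).2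
        | cons r₂' P' =>
          simp only [encode_cons_cons, List.append_assoc, List.cons_append, List.nil_append] at h
          obtain ⟨hr, ht⟩ := encodeRule_append_inj h
          obtain ⟨hP, hw⟩ := ih (P' := r₂' :: P')
            (by simpa only [List.append_assoc, List.cons_append, List.nil_append] using
              (List.cons.inj ht).2)
          exact ⟨by rw [hr, hP], hw⟩

/-! ### Computability of the coding -/

theorem primrec_unary : Primrec unary := by
  refine (Primrec.list_map (Primrec.list_range.comp Primrec.succ)
    (Primrec.const false).to₂).of_eq fun i => ?_
  simp [unary]

theorem primrec_moveNum : Primrec moveNum := Primrec.dom_finite _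

theorem primrec_encodeRule : Primrec encodeRule := by
  have hu {f : TMRule → ℕ} (hf : Primrec f) : Primrec fun r => unary (f r) := primrec_unary.comp hf
  have happ {f g : TMRule → List Bool} (hf : Primrec f) (hg : Primrec g) :
    Primrec fun r => f r ++ g r := Primrec.list_append.comp hf hg
  have h₁ : Primrec fun _ : TMRule => [true] := Primrec.const _
  exact happ (happ (happ (happ (happ (happ (happ (happ (hu TMRule.primrec_state) h₁)
    (hu TMRule.primrec_read)) h₁) (hu TMRule.primrec_next)) h₁) (hu TMRule.primrec_write)) h₁)
    (hu (primrec_moveNum.comp TMRule.primrec_dir))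

/-- Attaching each separator to the rule after it replaces the recursion by a `flatMap`, from which
primitive recursiveness can be read off. -/
theorem encode_cons (r : TMRule) (P : TMTable) :
    encode (r :: P) = encodeRule r ++ P.flatMap fun r => [true, true] ++ encodeRule r := by
  induction P generalizing r with
  | nil => simp [encode_singleton]
  | cons r' P ih => rw [encode_cons_cons, ih]; simp

theorem primrec_encode : Primrec encode := by
  have h₁ : Primrec fun r : TMRule => [true, true] ++ encodeRule r :=
    Primrec.list_append.comp (Primrec.const _) primrec_encodeRule
  have h₂ : Primrec₂ fun (_ : TMTable) (x : TMRule × TMTable) =>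
      encodeRule x.1 ++ x.2.flatMap fun r => [true, true] ++ encodeRule r :=
    Primrec.list_append.comp (primrec_encodeRule.comp (Primrec.fst.comp Primrec.snd))
      (Primrec.list_flatMap (Primrec.snd.comp Primrec.snd) (h₁.comp Primrec.snd).to₂)
  refine (Primrec.list_casesOn Primrec.id (Primrec.const []) h₂).of_eq fun P => ?_
  cases P with
  | nil => rfl
  | cons r P => exact (encode_cons r P).symm

theorem re_accepts : REPred fun x : TMTable × List Bool => x.1.Accepts x.2 := by
  have h : Computable fun x : TMTable × List Bool => (x.1, x.2.map fun b => cond b 2 1) :=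
    (Primrec.pair Primrec.fst (Primrec.list_map Primrec.snd
      ((Primrec.dom_bool fun b => cond b 2 1).comp Primrec.snd).to₂)).to_comp
  exact ((re_reachesState 1).comp h).of_eq fun x => (accepts_iff _ _).symm

end TMTable

theorem encode_append_mem_universalLanguage_iff (P : TMTable) (w : List Bool) :
    P.encode ++ [true, true, true] ++ w ∈ universalLanguage ↔ P.Accepts w := by
  constructor
  · rintro ⟨P', w', h, hP⟩
    obtain ⟨rfl, rfl⟩ := TMTable.encode_append_inj h
    exact hP
  · exact fun h => ⟨P, w, rfl, h⟩

theorem computable_encode_append :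
    Computable fun x : TMTable × List Bool => x.1.encode ++ [true, true, true] ++ x.2 :=
  (Primrec.list_append.comp (Primrec.list_append.comp (TMTable.primrec_encode.comp Primrec.fst)
    (Primrec.const [true, true, true])) Primrec.snd).to_comp

theorem re_universalLanguage : REPred fun z => z ∈ universalLanguage := by
  refine (TMTable.re_accepts.image computable_encode_append).of_eq fun z => ?_
  constructor
  · rintro ⟨⟨P, w⟩, h, hP⟩
    exact ⟨P, w, h.symm, hP⟩
  · rintro ⟨P, w, h, hP⟩
    exact ⟨⟨P, w⟩, h.symm, hP⟩

theorem computable_binNum : Computable binNum := by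
  refine (Primrec.list_foldl (h := fun _ x => Nat.bit x.2 x.1) Primrec.id (Primrec.const 1)
    ?_).to_comp
  have h : Primrec fun x : List Bool × ℕ × Bool => 2 * x.2.1 + x.2.2.toNat :=
    Primrec.nat_add.comp (Primrec.nat_mul.comp (Primrec.const 2) (Primrec.fst.comp Primrec.snd))
      ((Primrec.dom_bool Bool.toNat).comp (Primrec.snd.comp Primrec.snd))
  exact h.of_eq fun x => (Nat.bit_val _ _).symm

/-- Recursively enumerable languages are accepted by finite machines. -/
theorem REPred.exists_machine_of_list {L : List Bool → Prop} (hL : REPred L) {A : Type} [Finite A]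
    (c : A → Bool) :
    ∃ (Q Γ : Type) (_ : Finite Q) (_ : Finite Γ) (_ : Inhabited Γ)
      (δ : Q → Γ → Option (Q × Γ × HeadMove)) (q₀ q₁ : Q) (inp : A ↪ Γ),
      q₀ ≠ q₁ ∧ (∀ a, δ q₁ a = none) ∧ (∀ a, inp a ≠ default) ∧
      ∀ w : List A, ReachesState δ q₁ (q₀, Tape.mk₁ (w.map inp)) ↔ L (w.map c) := by
  simpa only [binNum_injective.eq_iff, exists_eq_left] using
    (hL.image computable_binNum).exists_machine c

theorem computable_replicate {α : Type*} [Primcodable α] (a : α) :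
    Computable fun n => List.replicate (n + 1) a := by
  refine ((Primrec.list_map (Primrec.list_range.comp Primrec.succ)
    (Primrec.const a).to₂).of_eq fun i => ?_).to_comp
  simp

theorem re_unary {K : ℕ → Prop} (hK : REPred K) :
    REPred fun w => ∃ n, List.replicate (n + 1) true = w ∧ K n :=
  hK.image (computable_replicate true)

theorem exists_replicate_eq_iff {α : Type*} {K : ℕ → Prop} {a : α} {n : ℕ} :
    (∃ m, List.replicate (m + 1) a = List.replicate (n + 1) a ∧ K m) ↔ K n := by
  refine ⟨fun ⟨m, hm, h⟩ => ?_, fun h => ⟨n, rfl, h⟩⟩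
  have := congrArg List.length hm
  simp only [List.length_replicate, Nat.add_right_cancel_iff] at this
  rwa [← this]

/-- If a fixed table `P` accepts the unary words of an r.e. set `K`, then `n ↦ ⟨P⟩ 111 1ⁿ⁺¹` reduces
the complement of `K` to the set in question; `K` is chosen so that this complement is not r.e. -/
theorem not_re_compl_universalLanguage :
    ¬ REPred fun w => w ≠ [] ∧ w ∉ universalLanguage := by
  intro h
  obtain ⟨K, hK, hK'⟩ := exists_re_not_co_re
  obtain ⟨Q, Γ, _, _, _, δ, q₀, q₁, inp, hq, -, hinp, hδ⟩ := (re_unary hK).exists_machine_of_list id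
  classical
  -- The list follows the convention for tables: `0` is the blank, `1` and `2` are the input
  -- symbols.
  obtain ⟨g, hg, hl⟩ := exists_numbering [default, inp false, inp true]
  have g₀ : g default = 0 := by simpa using hl default (by simp)
  have g₁ : g (inp false) = 1 := by
    simpa [List.idxOf_cons, (hinp false).symm] using hl (inp false) (by simp)
  have g₂ : g (inp true) = 2 := by
    simpa [List.idxOf_cons, (hinp true).symm] using hl (inp true) (by simp)
  obtain ⟨P, hP⟩ := TMTable.exists_reachesState_iff δ hq hg g₀
  have hacc (w : List Bool) : P.Accepts w ↔ ∃ n, List.replicate (n + 1) true = w ∧ K n := by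
    have := hP (w.map inp)
    rw [hδ, List.map_id] at this
    rw [← this, TMTable.accepts_iff, TMTable.init, List.map_map]
    have hb : (fun b : Bool => cond b 2 1) = g ∘ inp := by
      funext b; cases b <;> simp [g₁, g₂]
    rw [hb]
  refine hK' ((h.comp (computable_encode_append.comp
    (Computable.pair (Computable.const P) (computable_replicate true)))).of_eq fun n => ?_)
  rw [encode_append_mem_universalLanguage_iff, hacc, exists_replicate_eq_iff]
  simp

/-! ### Order in lattice-ordered QMV algebras -/

namespace SAlgebra

variable {E : Type*} [SAlgebra E]

theorem compl_zero : (0 : E)ᶜ = 1 := by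
  rw [← add_supp (0 : E), zero_add]

theorem compl_one : (1 : E)ᶜ = 0 := by
  rw [← compl_zero, supp_supp]

theorem one_add (a : E) : 1 + a = 1 := by rw [add_comm, add_one_eq]

theorem eq_zero_of_add_eq_zero {a b : E} (h : a + b = 0) : a = 0 := by
  have h₁ : aᶜ + (a + b) = 1 := by rw [← add_assoc, add_comm aᶜ, add_supp, one_add]
  rw [h, add_zero] at h₁
  rw [← supp_supp a, h₁, compl_one]

/-- Whether a sum vanishes depends only on which summands vanish, so one bit can follow this
property along a path. -/
theorem add_eq_zero_iff {a b : E} : a + b = 0 ↔ a = 0 ∧ b = 0 :=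
  ⟨fun h => ⟨eq_zero_of_add_eq_zero h, eq_zero_of_add_eq_zero (by rwa [add_comm])⟩,
    fun h => by rw [h.1, h.2, add_zero]⟩

end SAlgebra

namespace LatticeQMVAlgebra

open SAlgebra

variable {E : Type*} [LatticeQMVAlgebra E]

theorem le_one (a : E) : a ≤ 1 := by
  rw [le_iff_eq_qinf, qinf, odot, compl_one, add_zero, add_zero, supp_supp]

theorem zero_le (a : E) : 0 ≤ a := by
  rw [le_iff_eq_qinf, qinf, odot, zero_add, supp_supp, add_supp, compl_one]

theorem lt_one_iff_ne {a : E} : a < 1 ↔ a ≠ 1 := (le_one a).lt_iff_ne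

end LatticeQMVAlgebra

/-! ### Machines with values in a QMV algebra for recursively enumerable languages -/

namespace ENTM

open LatticeQMVAlgebra

variable {E : Type*} [LatticeQMVAlgebra E]

theorem halted_iff {A : Type} (M : ENTM E A) (C : M.ID) :
    M.Halted C ↔ (M.T C.st = 1 → ∀ q b D, M.δ C.st C.tape.head q b D = 1) := by
  rw [Halted, lt_one_iff_ne]
  tauto

section ofTrans

variable {A Q Γ : Type} [Finite Q] [Finite Γ] [Inhabited Γ]
  (δ : Q → Γ → Option (Q × Γ × HeadMove)) (q₀ q₁ : Q) (inp : A ↪ Γ) (hinp : ∀ a, inp a ≠ default)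
  (x : E)

open scoped Classical in
/-- The machine that either halts with value `x` after one step or simulates a deterministic
machine with transition function `δ`, taking the value `0` if the state `q₁` is reached. -/
noncomputable def ofTrans : ENTM E A where
  Q := Q ⊕ Bool
  finQ := inferInstance
  nonemptyQ := inferInstance
  Γ := Γ
  finΓ := inferInstance
  B := default
  inp := inp
  inp_ne_blank := hinp
  δ
    | Sum.inl q, a, Sum.inl q', b, D => if δ q a = some (q', b, D) then 0 else 1
    | Sum.inr false, _, Sum.inr true, _, _ => 0
    | _, _, _, _, _ => 1
  I
    | Sum.inl q => if q = q₀ then 0 else 1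
    | Sum.inr b => if b then 1 else 0
  T
    | Sum.inl q => if q = q₁ then 0 else 1
    | Sum.inr b => if b then x else 1

variable {δ q₀ q₁ inp hinp x}

/-- All initial values and transitions other than `1` are `0`, so a path gathers no value before its
final state. Apart from the two states of the guess, a path is a run of the simulated machine. -/
theorem path_ofTrans {s : List A} {n : ℕ} {C : (ofTrans δ q₀ q₁ inp hinp x).ID}
    {v : E} (hC : (ofTrans δ q₀ q₁ inp hinp x).Path s n C v) :
    v = 0 ∧ ((∃ q, C.st = Sum.inl q ∧
        Reaches (detStep δ) (q₀, Tape.mk₁ (s.map inp)) (q, C.tape)) ∨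
      (C.st = Sum.inr false ∧ n = 0) ∨ C.st = Sum.inr true) := by
  induction hC with
  | init q h =>
    rcases q with q | _ | _
    · by_cases hq : q = q₀
      · subst hq
        exact ⟨by simp [ofTrans], Or.inl ⟨q, rfl, Relation.ReflTransGen.refl⟩⟩
      · simp [ofTrans, hq] at h
    · exact ⟨by simp [ofTrans], Or.inr (Or.inl ⟨rfl, rfl⟩)⟩
    · simp [ofTrans] at h
  | @step n C v _ _ q b D h ih =>
    obtain ⟨p, t⟩ := C
    obtain ⟨rfl, ih⟩ := ih
    rcases p with p | _ | _
    · rcases q with q | _ | _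
      · by_cases hδ : δ p t.head = some (q, b, D)
        · refine ⟨?_, Or.inl ⟨q, rfl, ?_⟩⟩
          · have hδ' : δ p (Tape.head t) = some (q, b, D) := hδ
            simp [ofTrans, hδ']
          · rcases ih with ⟨p', hp, ih⟩ | ⟨hp, _⟩ | hp
            · cases hp
              refine ih.tail ?_
              simp only [detStep, Option.mem_def, Option.map_eq_some_iff]
              exact ⟨_, hδ, rfl⟩
            · cases hp
            · cases hp
        · exact absurd (if_neg hδ) h
      · exact absurd rfl h
      · exact absurd rfl h
    · rcases q with q | _ | _
      · exact absurd rfl h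
      · exact absurd rfl h
      · exact ⟨by simp [ofTrans], Or.inr (Or.inr rfl)⟩
    · exact absurd rfl h

/-- The bound on `n` serves the demand that halting paths have length at least `1`. As `q₁` has no
transitions, the simulation cannot pass through it and so does not halt too early. -/
theorem exists_path_ofTrans (h01 : (0 : E) ≠ 1) (hq₁ : ∀ a, δ q₁ a = none) {s : List A} {q : Q}
    {t : Tape Γ} (h : Reaches (detStep δ) (q₀, Tape.mk₁ (s.map inp)) (q, t)) :
    ∃ n, (q ≠ q₀ → 1 ≤ n) ∧ (ofTrans δ q₀ q₁ inp hinp x).Path s n ⟨Sum.inl q, t⟩ 0 := by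
  have key : ∀ c, Relation.ReflTransGen (fun a b => b ∈ detStep δ a)
      (q₀, Tape.mk₁ (s.map inp)) c → ∃ n, (c.1 ≠ q₀ → 1 ≤ n) ∧
        (ofTrans δ q₀ q₁ inp hinp x).Path s n ⟨Sum.inl c.1, c.2⟩ 0 := by
    intro c hc
    induction hc with
    | refl =>
      refine ⟨0, fun h => absurd rfl h, ?_⟩
      have := Path.init (M := ofTrans δ q₀ q₁ inp hinp x) (s := s) (Sum.inl q₀)
        (by simp [ofTrans, h01])
      simpa [ofTrans] using! this
    | @tail c d _ hs ih =>
      obtain ⟨n, -, hn⟩ := ih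
      obtain ⟨⟨q', b, D⟩, hδ, rfl⟩ := Option.map_eq_some_iff.1 hs
      have hv : (ofTrans δ q₀ q₁ inp hinp x).δ (Sum.inl c.1) c.2.head (Sum.inl q') b D = 0 :=
        if_pos hδ
      refine ⟨n + 1, fun _ => Nat.le_add_left 1 n, ?_⟩
      have := hn.step (q := Sum.inl q') (b := b) (D := D) ?_ (hv.trans_ne h01)
      · rw [hv, add_zero] at this
        exact this
      · rw [halted_iff]
        intro hh
        refine h01 (hv.symm.trans (hh ?_ _ _ _))
        have : c.1 ≠ q₁ := fun hc => by rw [hc, hq₁] at hδ; cases hδ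
        simp [ofTrans, this]
  exact key _ h

/-- A simulation that gets stuck outside `q₁` contributes `1`, which does not affect an infimum. -/
theorem pathValues_ofTrans_subset {s : List A} {v : E}
    (hv : v ∈ (ofTrans δ q₀ q₁ inp hinp x).pathValues s) :
    v = x ∨ v = 1 ∨ ReachesState δ q₁ (q₀, Tape.mk₁ (s.map inp)) := by
  obtain ⟨n, ⟨p, t⟩, u, hn, hp, -, rfl⟩ := hv
  obtain ⟨rfl, ⟨q, hq, h⟩ | ⟨-, rfl⟩ | h⟩ := path_ofTrans hp
  · cases hq
    by_cases hq : q = q₁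
    · subst hq
      exact Or.inr (Or.inr ⟨_, h⟩)
    · right; left; simp [ofTrans, hq]
  · omega
  · cases h
    left; simp [ofTrans]

theorem mem_pathValues_ofTrans (h01 : (0 : E) ≠ 1) (s : List A) :
    x ∈ (ofTrans δ q₀ q₁ inp hinp x).pathValues s := by
  have h₀ := Path.init (M := ofTrans δ q₀ q₁ inp hinp x) (s := s) (Sum.inr false)
    (by simp [ofTrans, h01])
  have h₁ := h₀.step (q := Sum.inr true) (b := default) (D := HeadMove.S) ?_ h01
  · refine ⟨1, _, _, le_rfl, h₁, ?_, ?_⟩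
    · rw [halted_iff]
      exact fun _ q b D => by rfl
    · simp [ofTrans, initID]
  · rw [halted_iff]
    exact fun h => h01 (h (by simp [ofTrans, initID]) (Sum.inr true) default HeadMove.S)

theorem zero_mem_pathValues_ofTrans (h01 : (0 : E) ≠ 1) (hq₁ : ∀ a, δ q₁ a = none) (hq : q₀ ≠ q₁)
    {s : List A} (h : ReachesState δ q₁ (q₀, Tape.mk₁ (s.map inp))) :
    0 ∈ (ofTrans δ q₀ q₁ inp hinp x).pathValues s := by
  obtain ⟨t, ht⟩ := h
  obtain ⟨n, hn, hp⟩ := exists_path_ofTrans (hinp := hinp) (x := x) h01 hq₁ ht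
  refine ⟨n, _, _, hn hq.symm, hp, ?_, ?_⟩
  · rw [halted_iff]
    exact fun h => absurd h (by simp [ofTrans, h01])
  · simp [ofTrans]

end ofTrans

/-- For a recursively enumerable language `L` there is a machine whose language has the value `0`
on `L` and the value `x` outside `L`. -/
theorem exists_lang_eq (h01 : (0 : E) ≠ 1) {L : List Bool → Prop} (hL : REPred L) {A : Type}
    [Finite A] (c : A → Bool) (x : E) :
    ∃ M : ENTM E A, ∀ s : NeWord A,
      (L (s.1.map c) → M.lang s = Part.some 0) ∧ (¬ L (s.1.map c) → M.lang s = Part.some x) := by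
  obtain ⟨Q, Γ, _, _, _, δ, q₀, q₁, inp, hq, hq₁, hinp, h⟩ := hL.exists_machine_of_list c
  refine ⟨ofTrans δ q₀ q₁ inp hinp x, fun s => ⟨fun hs => ?_, fun hs => ?_⟩⟩ <;>
    rw [Part.eq_some_iff, mem_lang_iff] <;> rw [← h] at hs
  · have := zero_mem_pathValues_ofTrans (hinp := hinp) (x := x) h01 hq₁ hq hs
    exact ⟨⟨_, this⟩, IsLeast.isGLB ⟨this, fun v _ => zero_le v⟩⟩
  · have := mem_pathValues_ofTrans (δ := δ) (q₀ := q₀) (q₁ := q₁) (hinp := hinp) (x := x) h01 s.1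
    -- The guessed value `x` is attained and the only other possible value is `1`, so the infimum
    -- exists without completeness of the order.
    refine ⟨⟨_, this⟩, IsLeast.isGLB ⟨this, fun v hv => ?_⟩⟩
    rcases pathValues_ofTrans_subset hv with rfl | rfl | h
    · exact le_rfl
    · exact le_one x
    · exact absurd h hs

end ENTM

/-! ### Deterministic machines with values in a QMV algebra -/

namespace ENTM

open LatticeQMVAlgebra

variable {E : Type*} [LatticeQMVAlgebra E] {A : Type} (M : ENTM E A)

/-- The state `q` and the scanned symbol `a` do not halt the machine and `r` is a transition
with value different from `1`. -/
def Effective (q : M.Q) (a : M.Γ) (r : M.Q × M.Γ × HeadMove) : Prop :=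
  ¬ (M.T q = 1 → ∀ q' b D, M.δ q a q' b D = 1) ∧ M.δ q a r.1 r.2.1 r.2.2 ≠ 1

open scoped Classical in
/-- The transition made by a deterministic machine, `none` if the machine halts. -/
noncomputable def next (q : M.Q) (a : M.Γ) : Option (M.Q × M.Γ × HeadMove) :=
  if h : ∃ r, M.Effective q a r then some h.choose else none

variable {M}

theorem effective_of_next_eq_some {q : M.Q} {a : M.Γ} {r : M.Q × M.Γ × HeadMove}
    (h : M.next q a = some r) : M.Effective q a r := by
  rw [next] at h
  split_ifs at h with h'
  cases h
  exact h'.choose_spec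

theorem next_eq_some (hM : M.IsDeterministic) {q : M.Q} {a : M.Γ} {r : M.Q × M.Γ × HeadMove}
    (h : M.Effective q a r) : M.next q a = some r := by
  have h' : ∃ r, M.Effective q a r := ⟨r, h⟩
  rw [next, dif_pos h', Option.some_inj]
  obtain ⟨h₁, h₂, h₃⟩ := hM.1 _ _ _ _ _ _ _ _ h'.choose_spec.2 h.2
  exact Prod.ext h₁ (Prod.ext h₂ h₃)

theorem next_eq_none_iff {C : M.ID} : M.next C.st C.tape.head = none ↔ M.Halted C := by
  rw [halted_iff, next]
  split_ifs with h
  · obtain ⟨r, hr⟩ := h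
    simp only [false_iff]
    exact hr.1
  · simp only [true_iff]
    by_contra h'
    obtain ⟨q, b, D, hδ⟩ : ∃ q b D, M.δ C.st C.tape.head q b D ≠ 1 := by
      by_contra! hc
      exact h' fun _ => hc
    exact h ⟨(q, b, D), h', hδ⟩

variable (M)

/-- The configuration (with the value of the path so far) after the transition `r`. -/
def advance (c : M.Q × Tape M.Γ × E) (r : M.Q × M.Γ × HeadMove) : M.Q × Tape M.Γ × E :=
  (r.1, writeMove c.2.1 r.2.1 r.2.2, c.2.2 + M.δ c.1 c.2.1.head r.1 r.2.1 r.2.2)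

/-- One step of a deterministic machine that keeps track of the value of the path, where the final
step adds the value of the final state. -/
noncomputable def valStep :
    (M.Q × Tape M.Γ × E) ⊕ (Tape M.Γ × E) → Option ((M.Q × Tape M.Γ × E) ⊕ (Tape M.Γ × E))
  | Sum.inl c => match M.next c.1 c.2.1.head with
    | some r => some (Sum.inl (M.advance c r))
    | none => some (Sum.inr (c.2.1, c.2.2 + M.T c.1))
  | Sum.inr _ => none

variable {M}

theorem valStep_of_next_eq_some {c : M.Q × Tape M.Γ × E} {r : M.Q × M.Γ × HeadMove}
    (h : M.next c.1 c.2.1.head = some r) :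
    M.valStep (Sum.inl c) = some (Sum.inl (M.advance c r)) := by
  simp [valStep, h]

theorem valStep_of_next_eq_none {c : M.Q × Tape M.Γ × E} (h : M.next c.1 c.2.1.head = none) :
    M.valStep (Sum.inl c) = some (Sum.inr (c.2.1, c.2.2 + M.T c.1)) := by
  simp [valStep, h]

variable (M) in
/-- The initial configuration with state `q`. -/
def initVal (q : M.Q) (s : List A) : M.Q × Tape M.Γ × E :=
  (q, Tape.mk₁ (s.map M.inp), M.I q)

/-- The middle clause records that a path of positive length starts at an ID that is not halted, a
condition that `valStep` alone does not see. -/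
theorem reaches_of_path (hM : M.IsDeterministic) {s : List A} {n : ℕ} {C : M.ID} {u : E}
    (h : M.Path s n C u) :
    ∃ q₀, M.I q₀ ≠ 1 ∧ (n ≠ 0 → M.next q₀ (Tape.mk₁ (s.map M.inp)).head ≠ none) ∧
      Reaches M.valStep (Sum.inl (M.initVal q₀ s)) (Sum.inl (C.st, C.tape, u)) := by
  induction h with
  | init q₀ h => exact ⟨q₀, h, fun h => absurd rfl h, Relation.ReflTransGen.refl⟩
  | @step n C u _ hn q b D h ih =>
    obtain ⟨q₀, h₀, h₁, hr⟩ := ih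
    rw [halted_iff] at hn
    have hs : M.next C.st C.tape.head = some (q, b, D) := next_eq_some hM ⟨hn, h⟩
    refine ⟨q₀, h₀, fun _ => ?_,
      hr.tail (valStep_of_next_eq_some (c := (C.st, C.tape, u)) hs)⟩
    -- If the initial ID were halted, `valStep` would pass at once to a final `Sum.inr`
    -- configuration, from which no `Sum.inl` configuration is reachable.
    intro hnone
    have := valStep_of_next_eq_none (M := M) (c := M.initVal q₀ s) hnone
    rcases Relation.ReflTransGen.cases_head hr with he | ⟨d, hd, hd'⟩
    · have h₁ : q₀ = C.st := congrArg Prod.fst (Sum.inl.inj he)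
      have h₂ : Tape.mk₁ (s.map M.inp) = C.tape := congrArg (fun c => c.2.1) (Sum.inl.inj he)
      rw [h₁, h₂, hs] at hnone
      cases hnone
    · rw [Option.mem_def, this, Option.some_inj] at hd
      subst hd
      rcases Relation.ReflTransGen.cases_head hd' with he | ⟨d, hd, -⟩
      · cases he
      · cases hd

theorem exists_path_of_reaches {s : List A} {q₀ : M.Q} (h₀ : M.I q₀ ≠ 1)
    {c : (M.Q × Tape M.Γ × E) ⊕ (Tape M.Γ × E)}
    (h : Relation.ReflTransGen (fun a b => b ∈ M.valStep a) (Sum.inl (M.initVal q₀ s)) c) :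
    (∃ p n, c = Sum.inl p ∧ (p ≠ M.initVal q₀ s → 1 ≤ n) ∧ M.Path s n ⟨p.1, p.2.1⟩ p.2.2) ∨
      ∃ t v, c = Sum.inr (t, v) ∧ (M.next q₀ (Tape.mk₁ (s.map M.inp)).head ≠ none →
        v ∈ M.pathValues s) := by
  induction h with
  | refl => exact Or.inl ⟨_, 0, rfl, fun h => absurd rfl h, Path.init q₀ h₀⟩
  | tail _ hs ih =>
    rcases ih with ⟨p, n, rfl, hn, hp⟩ | ⟨t, v, rfl, -⟩
    · rcases hnext : M.next p.1 p.2.1.head with _ | r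
      · rw [Option.mem_def, valStep_of_next_eq_none hnext, Option.some_inj] at hs
        subst hs
        refine Or.inr ⟨_, _, rfl, fun hne => ⟨n, _, _, hn ?_, hp, next_eq_none_iff.1 hnext, rfl⟩⟩
        rintro rfl
        exact hne hnext
      · rw [Option.mem_def, valStep_of_next_eq_some hnext, Option.some_inj] at hs
        subst hs
        refine Or.inl ⟨_, n + 1, rfl, fun _ => Nat.le_add_left 1 n, ?_⟩
        have hr := effective_of_next_eq_some hnext
        exact hp.step (by rw [halted_iff]; exact hr.1) _ _ _ hr.2
    · cases hs

/-- The values of the halting paths of a deterministic machine. -/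
theorem mem_pathValues_iff (hM : M.IsDeterministic) {s : List A} {v : E} :
    v ∈ M.pathValues s ↔ ∃ q₀, M.I q₀ ≠ 1 ∧ M.next q₀ (Tape.mk₁ (s.map M.inp)).head ≠ none ∧
      ∃ t, Sum.inr (t, v) ∈ StateTransition.eval M.valStep (Sum.inl (M.initVal q₀ s)) := by
  constructor
  · rintro ⟨n, C, u, hn, hp, hC, rfl⟩
    obtain ⟨q₀, h₀, h₁, hr⟩ := reaches_of_path hM hp
    refine ⟨q₀, h₀, h₁ (by omega), C.tape, mem_eval.2 ⟨hr.tail ?_, rfl⟩⟩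
    exact valStep_of_next_eq_none (c := (C.st, C.tape, u)) (next_eq_none_iff.2 hC)
  · rintro ⟨q₀, h₀, hn, t, ht⟩
    rcases exists_path_of_reaches h₀ (mem_eval.1 ht).1 with ⟨p, n, hp, -⟩ | ⟨t', v', he, h⟩
    · cases hp
    · cases he
      exact h hn

/-- The initial state is unique and evaluating the partial function `valStep` gives at most one
result. -/
theorem pathValues_subsingleton (hM : M.IsDeterministic) (s : List A) :
    (M.pathValues s).Subsingleton := by
  intro v hv v' hv'
  obtain ⟨q, hq, -, t, ht⟩ := (mem_pathValues_iff hM).1 hv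
  obtain ⟨q', hq', -, t', ht'⟩ := (mem_pathValues_iff hM).1 hv'
  cases hM.2 q q' hq hq'
  have := Part.mem_unique ht ht'
  simp only [Sum.inr.injEq, Prod.mk.injEq] at this
  exact this.2

theorem mem_lang_iff_of_isDeterministic (hM : M.IsDeterministic) (s : NeWord A) (v : E) :
    v ∈ M.lang s ↔ v ∈ M.pathValues s.1 := by
  rw [mem_lang_iff]
  constructor
  · rintro ⟨⟨w, hw⟩, h⟩
    have : M.pathValues s.1 = {w} := (pathValues_subsingleton hM s.1).eq_singleton_of_mem hw
    rw [this] at h ⊢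
    exact h.unique isGLB_singleton
  · intro hv
    have : M.pathValues s.1 = {v} := (pathValues_subsingleton hM s.1).eq_singleton_of_mem hv
    rw [this]
    exact ⟨⟨v, rfl⟩, isGLB_singleton⟩

/-! ### Deterministic languages with two values -/

section flag

variable (M)

open scoped Classical in
/-- The classical machine that simulates a deterministic machine, remembering whether the value
of the path is different from `0`. -/
noncomputable def flagTrans :
    (M.Q × Bool) ⊕ Bool → M.Γ → Option (((M.Q × Bool) ⊕ Bool) × M.Γ × HeadMove)
  | Sum.inl (q, f), a => match M.next q a with
    | some r => some (Sum.inl (r.1, f || decide (M.δ q a r.1 r.2.1 r.2.2 ≠ 0)), r.2)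
    | none => some (Sum.inr (f || decide (M.T q ≠ 0)), a, HeadMove.S)
  | Sum.inr _, _ => none

open scoped Classical in
/-- The configuration of the classical machine that corresponds to a configuration with a value. -/
noncomputable def flagCfg :
    (M.Q × Tape M.Γ × E) ⊕ (Tape M.Γ × E) → ((M.Q × Bool) ⊕ Bool) × Tape M.Γ
  | Sum.inl c => (Sum.inl (c.1, decide (c.2.2 ≠ 0)), c.2.1)
  | Sum.inr c => (Sum.inr (decide (c.2 ≠ 0)), c.1)

open scoped Classical in
theorem decide_add_ne_zero (a b : E) :
    decide (a + b ≠ 0) = (decide (a ≠ 0) || decide (b ≠ 0)) := by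
  rw [← Bool.decide_or, decide_eq_decide, ne_eq, SAlgebra.add_eq_zero_iff, not_and_or]

/-- By `decide_add_ne_zero` the flag of a sum is the disjunction of the flags, so it can be updated
without knowing the value. -/
theorem respects_flagCfg :
    Respects M.valStep (detStep M.flagTrans) fun a b => M.flagCfg a = b := by
  refine fun_respects.2 ?_
  rintro (⟨q, t, u⟩ | ⟨t, v⟩)
  · rcases h : M.next q t.head with _ | r
    · rw [valStep_of_next_eq_none h]
      refine Relation.TransGen.single ?_
      simp only [Option.mem_def, flagCfg, detStep, flagTrans, h, Option.map_some, writeMove_head,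
        decide_add_ne_zero]
    · rw [valStep_of_next_eq_some h]
      refine Relation.TransGen.single ?_
      simp only [Option.mem_def, flagCfg, detStep, flagTrans, h, Option.map_some, advance,
        ← decide_add_ne_zero]
      congr!
  · rfl

/-- The run is known to halt, so the classical machine stops in the state carrying the final flag;
uniqueness of evaluation rules out the other flag. -/
theorem reachesState_flagTrans_iff (hM : M.IsDeterministic) {q₀ : M.Q} (h₀ : M.I q₀ ≠ 1)
    {s : List A} {v : E} (hv : v ∈ M.pathValues s) :
    ReachesState M.flagTrans (Sum.inr true) ((M.flagCfg (Sum.inl (M.initVal q₀ s))).1,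
      Tape.mk₁ (s.map M.inp)) ↔ v ≠ 0 := by
  obtain ⟨q, hq, -, t, ht⟩ := (mem_pathValues_iff hM).1 hv
  cases hM.2 _ _ h₀ hq
  obtain ⟨_, rfl, h⟩ := StateTransition.tr_eval M.respects_flagCfg rfl ht
  rw [mem_eval] at h
  constructor
  · rintro ⟨t', ht'⟩ rfl
    have h' := mem_eval.2 ⟨ht', (rfl : detStep M.flagTrans (Sum.inr true, t') = none)⟩
    have := Part.mem_unique h' (mem_eval.2 h)
    simp [flagCfg] at this
  · intro hv
    refine ⟨t, ?_⟩
    have := h.1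
    simp only [flagCfg, ne_eq, hv, not_false_eq_true, decide_true] at this ⊢
    exact this

/-- If a deterministic machine has a total language then its value is different from `0` on a
recursively enumerable set of unary words. -/
theorem re_lang_ne_zero (hM : M.IsDeterministic) (a : A) (htot : ∀ s : NeWord A, (M.lang s).Dom) :
    REPred fun n => (0 : E) ∉ M.lang ⟨List.replicate (n + 1) a, by simp⟩ := by
  have hval (n : ℕ) : ∃ v, v ∈ M.pathValues (List.replicate (n + 1) a) := by
    obtain ⟨v, hv⟩ := Part.dom_iff_mem.1 (htot ⟨List.replicate (n + 1) a, by simp⟩)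
    exact ⟨v, (mem_lang_iff_of_isDeterministic hM _ _).1 hv⟩
  -- Any one input yields the initial state, and by determinism it serves all inputs.
  obtain ⟨v, hv⟩ := hval 0
  obtain ⟨q₀, h₀, -⟩ := (mem_pathValues_iff hM).1 hv
  have := M.finQ
  have := M.finΓ
  obtain ⟨g, hg, hl⟩ := exists_numbering [(default : M.Γ)]
  have g₀ : g default = 0 := by classical simpa using hl default (by simp)
  obtain ⟨P, hP⟩ := TMTable.exists_reachesState_iff M.flagTrans
    -- Only the state and the flag of `M.I q₀` are used here; they do not depend on the word, so the
    -- empty one will do.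
    (q₀ := (M.flagCfg (Sum.inl (M.initVal q₀ []))).1) (q₁ := Sum.inr true)
    (by simp [flagCfg]) hg g₀
  refine ((TMTable.re_reachesState 1).comp (Computable.pair (Computable.const P)
    (computable_replicate (g (M.inp a))))).of_eq fun n => ?_
  obtain ⟨v, hv⟩ := hval n
  have h₁ := hP ((List.replicate (n + 1) a).map M.inp)
  rw [List.map_replicate, List.map_replicate] at h₁
  rw [h₁, ← List.map_replicate, mem_lang_iff_of_isDeterministic hM]
  refine (reachesState_flagTrans_iff M hM h₀ hv).trans (not_congr ?_)
  exact ⟨fun h => h ▸ hv, fun h => pathValues_subsingleton hM _ hv h⟩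

end flag

end ENTM

/-- The separating language is `0` on words whose length codes an element of `K` and `1` elsewhere:
all letters are identified, so only the length matters. -/
theorem dtmLanguages_ssubset_ntmLanguages {E : Type*} [LatticeQMVAlgebra E] (hE : (0 : E) ≠ 1)
    (A : Type) [Finite A] [Nonempty A] : dtmLanguages E A ⊂ ntmLanguages E A := by
  refine ⟨fun L ⟨M, _, hL⟩ => ⟨M, hL⟩, fun hsub => ?_⟩
  obtain ⟨K, hK, hK'⟩ := exists_re_not_co_re
  obtain ⟨a⟩ := ‹Nonempty A›
  obtain ⟨M, hM⟩ := ENTM.exists_lang_eq hE (re_unary hK) (fun _ : A => true) 1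
  obtain ⟨N, hN, hMN⟩ := hsub ⟨M, rfl⟩
  refine hK' ((N.re_lang_ne_zero hN a fun s => ?_).of_eq fun n => ?_)
  · rw [← hMN]
    by_cases h : ∃ n, List.replicate (n + 1) true = s.1.map (fun _ => true) ∧ K n
    · rw [(hM s).1 h]; trivial
    · rw [(hM s).2 h]; trivial
  · rw [← hMN]
    have h := hM ⟨List.replicate (n + 1) a, by simp⟩
    simp only [List.map_replicate, exists_replicate_eq_iff] at h
    by_cases hn : K n
    · simp [h.1 hn, hn]
    · simp [h.2 hn, hn, hE]

/-! ### Simulation by two-tape machines -/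

/-- The multiples of a nonzero element are `1` from some point on, so cyclic submonoids are finite,
and a sum of two finite submonoids is finite. -/
theorem IsLocallyFinite.finite_closure {E : Type*} [SAlgebra E] (hE : IsLocallyFinite E)
    {S : Set E} (hS : S.Finite) : (AddSubmonoid.closure S : Set E).Finite := by
  induction S, hS using Set.Finite.induction_on with
  | empty => simp
  | @insert a S _ _ ih =>
    have ha : (AddSubmonoid.closure {a} : Set E).Finite := by
      by_cases h0 : a = 0
      · simp [h0, AddSubmonoid.closure_singleton_zero]
      · obtain ⟨n, hn⟩ := hE a h0
        refine ((Set.finite_le_nat n).image fun k => k • a).subset fun x hx => ?_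
        obtain ⟨k, rfl⟩ := AddSubmonoid.mem_closure_singleton.1 hx
        rcases le_total k n with h | h
        · exact ⟨k, h, rfl⟩
        · refine ⟨n, le_refl n, ?_⟩
          obtain ⟨m, rfl⟩ := Nat.exists_eq_add_of_le h
          simp only [add_nsmul, hn, SAlgebra.one_add]
    refine (Set.Finite.image2 (fun x y => x + y) ha ih).subset fun x hx => ?_
    rw [← Set.singleton_union, AddSubmonoid.closure_union] at hx
    obtain ⟨y, hy, z, hz, rfl⟩ := AddSubmonoid.mem_sup.1 hx
    exact ⟨y, hy, z, hz, rfl⟩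

theorem Set.Finite.exists_code {E : Type*} {F : Set E} (hF : F.Finite) (hne : F.Nonempty) :
    ∃ (n : ℕ) (val : Fin n → E) (code : E → Fin n), ∀ x ∈ F, val (code x) = x := by
  classical
  have := hF.to_subtype
  obtain ⟨n, ⟨e⟩⟩ := Finite.exists_equiv_fin F
  obtain ⟨y, hy⟩ := hne
  refine ⟨n, fun i => (e.symm i : E), fun x => if h : x ∈ F then e ⟨x, h⟩ else e ⟨y, hy⟩, ?_⟩
  intro x hx
  simp [hx]

namespace ENTM

variable {E : Type*} [LatticeQMVAlgebra E] {A : Type} (M : ENTM E A)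

section twoTape

variable (init : Option M.Q) {G : Type} [Finite G] (val : G → E) (code : E → G)

/-- The two-tape machine that simulates a deterministic machine with initial state `init` and keeps
the value of the path in a cell of the second tape. State `Sum.inr 0` is the initial state, in state
`Sum.inr 1` the machine loops and in state `Sum.inr 2` it halts. -/
noncomputable def twoTape : TwoTapeTM A where
  K := M.Q ⊕ Fin 3
  finK := have := M.finQ; inferInstance
  Γ₁ := M.Γ
  finΓ₁ := M.finΓ
  B₁ := M.B
  Γ₂ := G
  finΓ₂ := inferInstance
  B₂ := code 0
  inp := M.inp
  inp_ne_blank := M.inp_ne_blank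
  start := Sum.inr 0
  δ
    | Sum.inl q, a, b => match M.next q a with
      | some r => some (Sum.inl r.1, r.2, code (val b + M.δ q a r.1 r.2.1 r.2.2), HeadMove.S)
      | none => some (Sum.inr 2, (a, HeadMove.S), code (val b + M.T q), HeadMove.S)
    | Sum.inr 0, a, b => match init.bind fun q => (M.next q a).map fun r => (q, r) with
      | some (q, r) => some (Sum.inl r.1, r.2, code (M.I q + M.δ q a r.1 r.2.1 r.2.2), HeadMove.S)
      | none => some (Sum.inr 1, (a, HeadMove.S), b, HeadMove.S)
    | Sum.inr 1, a, b => some (Sum.inr 1, (a, HeadMove.S), b, HeadMove.S)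
    | Sum.inr 2, _, _ => none

/-- The second tape of the simulating machine. -/
noncomputable def cell (b : G) : Tape (M.twoTape init val code).Γ₂ := (Tape.mk₁ []).write b

theorem writeMove_cell (b b' : G) : writeMove (M.cell init val code b) b' HeadMove.S =
    M.cell init val code b' := rfl

/-- The configuration of the two-tape machine that corresponds to a configuration with a value. -/
noncomputable def twoTapeCfg :
    (M.Q × Tape M.Γ × E) ⊕ (Tape M.Γ × E) → (M.twoTape init val code).Cfg
  | Sum.inl c => ⟨Sum.inl c.1, c.2.1, M.cell init val code (code c.2.2)⟩
  | Sum.inr c => ⟨Sum.inr 2, c.1, M.cell init val code (code c.2)⟩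

/-- The value in a configuration. -/
def cfgValue : (M.Q × Tape M.Γ × E) ⊕ (Tape M.Γ × E) → E
  | Sum.inl c => c.2.2
  | Sum.inr c => c.2

variable {init val code}

/-- Decoding inverts `code` only on `F`, so the simulation relation must also carry membership of
the running value in `F`. -/
theorem respects_twoTapeCfg {F : AddSubmonoid E} (hcode : ∀ x ∈ F, val (code x) = x)
    (hδ : ∀ p a q b D, M.δ p a q b D ∈ F) (hT : ∀ q, M.T q ∈ F) :
    Respects M.valStep (M.twoTape init val code).step
      fun c d => M.cfgValue c ∈ F ∧ M.twoTapeCfg init val code c = d := by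
  rintro (⟨q, t, u⟩ | ⟨t, v⟩) _ ⟨hc, rfl⟩
  · have hu : val (code u) = u := hcode u hc
    have hstep : (M.twoTape init val code).step (M.twoTapeCfg init val code (Sum.inl (q, t, u))) =
      (match M.next q t.head with
        | some r => some (Sum.inl r.1, r.2,
            code (val (code u) + M.δ q t.head r.1 r.2.1 r.2.2), HeadMove.S)
        | none => some (Sum.inr 2, (t.head, HeadMove.S), code (val (code u) + M.T q),
            HeadMove.S) : Option ((M.Q ⊕ Fin 3) × (M.Γ × HeadMove) × (G × HeadMove))).map fun r =>
        ⟨r.1, writeMove t r.2.1.1 r.2.1.2, writeMove (M.cell init val code (code u)) r.2.2.1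
          r.2.2.2⟩ := rfl
    rcases h : M.next q t.head with _ | r
    · rw [valStep_of_next_eq_none h]
      refine ⟨_, ⟨F.add_mem hc (hT q), rfl⟩, Relation.TransGen.single ?_⟩
      rw [Option.mem_def, hstep]
      simp only [h, Option.map_some, hu, writeMove_cell]
      rfl
    · rw [valStep_of_next_eq_some h]
      refine ⟨_, ⟨F.add_mem hc (hδ _ _ _ _ _), rfl⟩, Relation.TransGen.single ?_⟩
      rw [Option.mem_def, hstep]
      simp only [h, Option.map_some, hu, writeMove_cell]
      rfl
  · rfl

/-- The first step of the simulation already performs the first transition, since halting paths have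
length at least `1`. Without an initial state, or when the initial ID is halted, the language is
undefined and the machine enters its loop. -/
theorem twoTape_step_init (s : List A) :
    (M.twoTape init val code).step ((M.twoTape init val code).init s) =
      some (match init.bind fun q =>
          (M.next q (Tape.mk₁ (s.map M.inp)).head).map fun r => (q, r) with
        | some (q, r) => M.twoTapeCfg init val code (Sum.inl (M.advance (M.initVal q s) r))
        | none => ⟨Sum.inr 1, Tape.mk₁ (s.map M.inp), Tape.mk₁ []⟩) := by
  have hstep : (M.twoTape init val code).step ((M.twoTape init val code).init s) =
      (match init.bind fun q =>
          (M.next q (Tape.mk₁ (s.map M.inp)).head).map fun r => (q, r) with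
        | some (q, r) => some (Sum.inl r.1, r.2,
            code (M.I q + M.δ q (Tape.mk₁ (s.map M.inp)).head r.1 r.2.1 r.2.2), HeadMove.S)
        | none => some (Sum.inr 1, ((Tape.mk₁ (s.map M.inp)).head, HeadMove.S), code 0,
            HeadMove.S) : Option ((M.Q ⊕ Fin 3) × (M.Γ × HeadMove) × (G × HeadMove))).map fun r =>
        ⟨r.1, writeMove (Tape.mk₁ (s.map M.inp)) r.2.1.1 r.2.1.2, writeMove (Tape.mk₁ []) r.2.2.1
          r.2.2.2⟩ := rfl
  rw [hstep]
  rcases init.bind fun q =>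
      (M.next q (Tape.mk₁ (s.map M.inp)).head).map fun r => (q, r) with _ | ⟨q, r⟩
  · simp only [Option.map_some]
    rfl
  · rfl

theorem notMem_eval_of_loop {t : Tape M.Γ} {t' : Tape (M.twoTape init val code).Γ₂}
    {c : (M.twoTape init val code).Cfg} :
    c ∉ StateTransition.eval (M.twoTape init val code).step ⟨Sum.inr 1, t, t'⟩ := by
  intro hc
  obtain ⟨hr, hn⟩ := mem_eval.1 hc
  have key : ∀ d, Relation.ReflTransGen (fun a b => b ∈ (M.twoTape init val code).step a)
      ⟨Sum.inr 1, t, t'⟩ d → d.st = Sum.inr 1 := by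
    intro d hd
    induction hd with
    | refl => rfl
    | @tail d e _ hs ih =>
      obtain ⟨p, t₁, t₂⟩ := d
      cases ih
      cases hs
      rfl
  have := key _ hr
  obtain ⟨p, t₁, t₂⟩ := c
  cases this
  cases hn

end twoTape

variable {M}

/-- Every path value lies in the submonoid generated by the values of `I`, `T` and `δ`. It is
finite, so its elements can serve as second-tape symbols. -/
theorem exists_twoTapeTM (hE : IsLocallyFinite E) (hM : M.IsDeterministic) :
    ∃ (N : TwoTapeTM A) (val : N.Γ₂ → E), ∀ s : NeWord A,
      M.lang s = (N.output s.1).map val := by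
  classical
  have := M.finQ
  have := M.finΓ
  let F := AddSubmonoid.closure (Set.range M.I ∪ Set.range M.T ∪ Set.range
    fun x : M.Q × M.Γ × M.Q × M.Γ × HeadMove => M.δ x.1 x.2.1 x.2.2.1 x.2.2.2.1 x.2.2.2.2)
  have hF : (F : Set E).Finite := hE.finite_closure
    (((Set.finite_range _).union (Set.finite_range _)).union (Set.finite_range _))
  have hI (q) : M.I q ∈ F := AddSubmonoid.subset_closure (Or.inl (Or.inl ⟨q, rfl⟩))
  have hT (q) : M.T q ∈ F := AddSubmonoid.subset_closure (Or.inl (Or.inr ⟨q, rfl⟩))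
  have hδ (p a q b D) : M.δ p a q b D ∈ F :=
    AddSubmonoid.subset_closure (Or.inr ⟨(p, a, q, b, D), rfl⟩)
  obtain ⟨n, val, code, hcode⟩ := hF.exists_code ⟨0, F.zero_mem⟩
  obtain ⟨init, hinit⟩ : ∃ init : Option M.Q, ∀ q, M.I q ≠ 1 ↔ init = some q := by
    by_cases h : ∃ q, M.I q ≠ 1
    · obtain ⟨q, hq⟩ := h
      refine ⟨some q, fun q' => ⟨fun hq' => by rw [hM.2 q q' hq hq'], fun h => ?_⟩⟩
      cases h
      exact hq
    · refine ⟨none, fun q => ⟨fun hq => absurd ⟨q, hq⟩ h, fun h => by cases h⟩⟩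
  have hresp := M.respects_twoTapeCfg (init := init) hcode hδ hT
  refine ⟨M.twoTape init val code, val, fun s => Part.ext fun v => ?_⟩
  have hout : v ∈ ((M.twoTape init val code).output s.1).map val ↔
      ∃ c ∈ StateTransition.eval (M.twoTape init val code).step ((M.twoTape init val code).init s.1),
        val c.tape₂.head = v := by
    refine (Part.mem_map_iff _).trans ⟨?_, ?_⟩
    · rintro ⟨_, hb, rfl⟩
      obtain ⟨c, hc, rfl⟩ := (Part.mem_map_iff _).1 hb
      exact ⟨c, hc, rfl⟩
    · rintro ⟨c, hc, rfl⟩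
      exact ⟨_, (Part.mem_map_iff _).2 ⟨c, hc, rfl⟩, rfl⟩
  rw [mem_lang_iff_of_isDeterministic hM, mem_pathValues_iff hM]
  refine Iff.trans ?_ hout.symm
  -- The special first step is removed here; from then on both machines run in lockstep.
  rw [reaches_eval (Relation.ReflTransGen.single (M.twoTape_step_init s.1))]
  rcases hb : (init.bind fun q =>
      (M.next q (Tape.mk₁ (s.1.map M.inp)).head).map fun r => (q, r)) with _ | ⟨q, r⟩
  · constructor
    · rintro ⟨q, hq, hn, -⟩
      rw [(hinit q).1 hq] at hb
      simp only [Option.bind_some, Option.map_eq_none_iff] at hb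
      exact absurd hb hn
    · rintro ⟨c, hc, -⟩
      exact absurd hc (M.notMem_eval_of_loop)
  · obtain ⟨q', hq', hr⟩ := Option.bind_eq_some_iff.1 hb
    obtain ⟨r', hr, he⟩ := Option.map_eq_some_iff.1 hr
    cases he
    have hq : M.I q ≠ 1 := (hinit q).2 hq'
    have hstep := valStep_of_next_eq_some (M := M) (c := M.initVal q s.1) hr
    have hrel : M.cfgValue (Sum.inl (M.advance (M.initVal q s.1) r)) ∈ F :=
      F.add_mem (hI q) (hδ _ _ _ _ _)
    constructor
    · rintro ⟨q', hq', -, t, ht⟩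
      cases hM.2 q q' hq hq'
      rw [reaches_eval (Relation.ReflTransGen.single hstep)] at ht
      obtain ⟨_, ⟨hv, rfl⟩, hc⟩ := StateTransition.tr_eval hresp ⟨hrel, rfl⟩ ht
      exact ⟨_, hc, hcode v hv⟩
    · rintro ⟨c, hc, rfl⟩
      obtain ⟨d, ⟨hv, rfl⟩, hd⟩ := tr_eval_rev hresp ⟨hrel, rfl⟩ hc
      refine ⟨q, hq, by rw [hr]; simp, ?_⟩
      rw [reaches_eval (Relation.ReflTransGen.single hstep)]
      rcases d with d | ⟨t, v⟩
      -- A `Sum.inl` configuration always has a successor under `valStep`, so it cannot be final.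
      · have := (mem_eval.1 hd).2
        rw [valStep] at this
        split at this <;> cases this
      · refine ⟨t, ?_⟩
        have : val (code v) = v := hcode v hv
        change Sum.inr (t, val (code v)) ∈ _
        rwa [this]

end ENTM

/-! ### The main theorem -/

theorem mainTheorem1 {E : Type*} [LatticeQMVAlgebra E] (hE : (0 : E) ≠ 1) :
    (∀ (A : Type) [Finite A] [Nonempty A], dtmLanguages E A ⊂ ntmLanguages E A) ∧
    (IsLocallyFinite E → ∀ (A : Type) [Finite A] (M : ENTM E A), M.IsDeterministic →
      ∃ (N : TwoTapeTM A) (val : N.Γ₂ → E), ∀ s : NeWord A,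
        M.lang s = (N.output s.1).map val) ∧
    (∀ x : E, 0 < x → x < 1 → ∃ M : ENTM E Bool,
      (∀ s : NeWord Bool, s.1 ∈ universalLanguage → M.lang s = Part.some 0) ∧
      (∀ s : NeWord Bool, s.1 ∉ universalLanguage → M.lang s = Part.some x) ∧
      levelSet M.lang x = {w | w ≠ [] ∧ w ∉ universalLanguage} ∧
      ¬ REPred fun w : List Bool => w ∈ levelSet M.lang x) := by
  refine ⟨fun A _ _ => dtmLanguages_ssubset_ntmLanguages hE A,
    fun h _ _ _ hM => ENTM.exists_twoTapeTM h hM, fun x hx _ => ?_⟩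
  obtain ⟨M, hM⟩ := ENTM.exists_lang_eq hE re_universalLanguage id x
  simp only [List.map_id] at hM
  have hlev : levelSet M.lang x = {w | w ≠ [] ∧ w ∉ universalLanguage} := by
    ext w
    constructor
    · rintro ⟨hw, hxw⟩
      refine ⟨hw, fun h => ?_⟩
      rw [(hM ⟨w, hw⟩).1 h, Part.mem_some_iff] at hxw
      exact hx.ne' hxw
    · rintro ⟨hw, h⟩
      refine ⟨hw, ?_⟩
      rw [(hM ⟨w, hw⟩).2 h]
      exact Part.mem_some x
  refine ⟨M, fun s => (hM s).1, fun s => (hM s).2, hlev, ?_⟩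
  rw [hlev]
  exact not_re_compl_universalLanguage
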